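/- Let $\Bbbk$ be a field, $q\in\Bbbk^\times$, $0\neq h\in\Bbbk[t]$, and let $\sigma$ be the $\Bbbk$-algebra automorphism of $\Bbbk[t]$ with $\sigma(t)=qt$; assume that $\sigma$ has finite order $n=|\sigma|\ge 1$. Let $W=\Bbbk[t](x,y,\sigma,h)$ be the quantum generalized Weyl algebra of degree one, that is, the $\Bbbk$-algebra generated over $\Bbbk[t]$ by $x,y$ with relations $xy=h$, $yx=\sigma^{-1}(h)$, $xr=\sigma(r)x$, $yr=\sigma^{-1}(r)y$ for all $r\in\Bbbk[t]$, and let $Z$ be its center. Conventions. Let $B$ be a prime ring with a central subring $R$ such that $R$ is a domain with fraction field $F$, $B$ is a finitely generated $R$-module, and the regular trace $\operatorname{tr}:B\to F$ (the trace of left multiplication on $F\otimes_R B$) takes values in $R$. Let $w=\dim_F(F\otimes_R B)$, and let $\mathrm{MD}(B/R)\subseteq R$ be the ideal generated by all $\det(\operatorname{tr}(u_iu'_j))_{i,j=1}^{w}$ with $u_1,\dots,u_w,u'_1,\dots,u'_w\in B$. Write $(-)^\vee=\operatorname{Hom}_R(-,R)$; for a submodule $M$ of a reflexive $R$-module $N$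 with $N/M$ torsion, $M^{\vee\vee}$ is viewed inside $N=N^{\vee\vee}$. An element $d\in R$ is a reflexive hull discriminant of $B$ over $R$ if $\mathrm{MD}(B/R)^{\vee\vee}=dR$. If $B$ is a reflexive $R$-module, an element $d\in B$ is an extended reflexive hull discriminant of $B$ over $R$ if $d$ is normal ($dB=Bd$) and $(\mathrm{MD}(B/R)B)^{\vee\vee}=dB$. Then: 1. The elements $a=x^n$, $b=y^n$, $c=t^n$ lie in $Z$, there is a polynomial $p$ over $\Bbbk$ with $p(t^n)=\prod_{j=0}^{n-1}h(q^jt)$, and $a,b,c$ generate $Z$ with the single relation $ab=p(c)$, i.e. $Z=\Bbbk[a,b,c]/(ab-p(c))$. 2. The pair $(W,Z)$ satisfies the conditions required of $(B,R)$ above, and a reflexive hull discriminant of $W$ over $Z$ exists: the reflexive hull discriminants are exactly the elements $u\,c^{n(n-1)}=u\,t^{n^2(n-1)}$ with $u\in Z^\times$. 3. $W$ is a reflexive $Z$-module, and an extended reflexive hull discriminant of $W$ over $Z$ exists: the extended reflexive hull discriminants are exactly the elements $u\,t^{n^2(n-1)}$ with $u\in W^\times$. -/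

import Mathlib

open Polynomial
open scoped TensorProduct

/-! ## Generalized Weyl algebras of degree one -/

section GWA

/-- The defining relations of the degree one generalized Weyl algebra `R(x, y, σ, h)`, imposed on
the free `k`-algebra on the set `R ⊔ {x, y}` (`true` stands for `x`, `false` for `y`). The first
three relations say that the canonical map from `R` is a homomorphism of `k`-algebras. -/
inductive GWARel (k : Type*) {R : Type*} [CommRing k] [Ring R] [Algebra k R]
    (σ : R ≃ₐ[k] R) (h : R) :
    FreeAlgebra k (R ⊕ Bool) → FreeAlgebra k (R ⊕ Bool) → Prop
  | add (r s : R) : GWARel k σ h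
      (FreeAlgebra.ι k (Sum.inl (r + s)))
      (FreeAlgebra.ι k (Sum.inl r) + FreeAlgebra.ι k (Sum.inl s))
  | mul (r s : R) : GWARel k σ h
      (FreeAlgebra.ι k (Sum.inl (r * s)))
      (FreeAlgebra.ι k (Sum.inl r) * FreeAlgebra.ι k (Sum.inl s))
  | scalar (c : k) : GWARel k σ h
      (FreeAlgebra.ι k (Sum.inl (algebraMap k R c)))
      (algebraMap k (FreeAlgebra k (R ⊕ Bool)) c)
  | xy : GWARel k σ h
      (FreeAlgebra.ι k (Sum.inr true) * FreeAlgebra.ι k (Sum.inr false))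
      (FreeAlgebra.ι k (Sum.inl h))
  | yx : GWARel k σ h
      (FreeAlgebra.ι k (Sum.inr false) * FreeAlgebra.ι k (Sum.inr true))
      (FreeAlgebra.ι k (Sum.inl (σ.symm h)))
  | xr (r : R) : GWARel k σ h
      (FreeAlgebra.ι k (Sum.inr true) * FreeAlgebra.ι k (Sum.inl r))
      (FreeAlgebra.ι k (Sum.inl (σ r)) * FreeAlgebra.ι k (Sum.inr true))
  | yr (r : R) : GWARel k σ h
      (FreeAlgebra.ι k (Sum.inr false) * FreeAlgebra.ι k (Sum.inl r))
      (FreeAlgebra.ι k (Sum.inl (σ.symm r)) * FreeAlgebra.ι k (Sum.inr false))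

/-- The degree one generalized Weyl algebra `R(x, y, σ, h)`: generated over `R` by `x` and `y`
modulo `xy = h`, `yx = σ⁻¹(h)`, `xr = σ(r)x`, `yr = σ⁻¹(r)y` for all `r ∈ R`. (It is used for
`h` central and nonzero.) -/
def GWA (k : Type*) {R : Type*} [CommRing k] [Ring R] [Algebra k R]
    (σ : R ≃ₐ[k] R) (h : R) : Type _ :=
  RingQuot (GWARel k σ h)

namespace GWA

variable {k R : Type*} [CommRing k] [Ring R] [Algebra k R] (σ : R ≃ₐ[k] R) (h : R)

instance instRing : Ring (GWA k σ h) := inferInstanceAs (Ring (RingQuot (GWARel k σ h)))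

instance instAlgebra : Algebra k (GWA k σ h) :=
  inferInstanceAs (Algebra k (RingQuot (GWARel k σ h)))

/-- The quotient map from the free algebra. -/
def mk : FreeAlgebra k (R ⊕ Bool) →ₐ[k] GWA k σ h := RingQuot.mkAlgHom k (GWARel k σ h)

theorem mk_eq_of_rel {u v : FreeAlgebra k (R ⊕ Bool)} (huv : GWARel k σ h u v) :
    mk σ h u = mk σ h v :=
  RingQuot.mkAlgHom_rel k huv

/-- The canonical homomorphism from the base ring `R`. -/
def ofBase : R →ₐ[k] GWA k σ h where
  toFun r := mk σ h (FreeAlgebra.ι k (Sum.inl r))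
  map_one' := by
    have e := mk_eq_of_rel σ h (GWARel.scalar (1 : k))
    simpa using e
  map_zero' := by
    have e := mk_eq_of_rel σ h (GWARel.scalar (0 : k))
    simpa using e
  map_mul' r s := by
    have e := mk_eq_of_rel σ h (GWARel.mul r s)
    simpa using e
  map_add' r s := by
    have e := mk_eq_of_rel σ h (GWARel.add r s)
    simpa using e
  commutes' c := by
    have e := mk_eq_of_rel σ h (GWARel.scalar c)
    rw [e, AlgHom.commutes]

/-- The generator `x`. -/
def x : GWA k σ h := mk σ h (FreeAlgebra.ι k (Sum.inr true))

/-- The generator `y`. -/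
def y : GWA k σ h := mk σ h (FreeAlgebra.ι k (Sum.inr false))

end GWA

end GWA

/-! ## An algebra as an algebra over its center -/

/-- A `k`-algebra is an algebra over its center, by inclusion. -/
instance Subalgebra.centerAlgebra (k A : Type*) [CommRing k] [Ring A] [Algebra k A] :
    Algebra (Subalgebra.center k A) A where
  algebraMap := (Subalgebra.center k A).val.toRingHom
  commutes' r a := (Subalgebra.mem_center_iff.1 r.2 a).symm
  smul_def' _ _ := rfl

/-! ## Modified discriminant ideals and reflexive hull discriminants -/

section Discriminant

noncomputable section

/-- The rank `w` of `B_F = F ⊗ B` over the fraction field `F` of `R`. -/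
def genericRank (R B : Type*) [CommRing R] [Ring B] [Algebra R B] : ℕ :=
  Module.finrank (FractionRing R) (FractionRing R ⊗[R] B)

/-- The regular trace `B → End_F(B_F) → F`: the trace of left multiplication by `b` on
`B_F = F ⊗ B`, where `F` is the fraction field of `R`. -/
def regularTrace (R : Type*) {B : Type*} [CommRing R] [Ring B] [Algebra R B] (b : B) :
    FractionRing R :=
  LinearMap.trace (FractionRing R) (FractionRing R ⊗[R] B)
    (LinearMap.mulLeft (FractionRing R) ((1 : FractionRing R) ⊗ₜ[R] b))

/-- `B` is a prime ring which is a finitely generated module over the central subring `R`,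
and the regular trace takes values in `R`. -/
structure DiscriminantHypothesis (R B : Type*) [CommRing R] [Ring B] [Algebra R B] : Prop where
  isDomain : IsDomain R
  injective : Function.Injective (algebraMap R B)
  nontrivial : Nontrivial B
  prime : ∀ a b : B, (∀ r : B, a * r * b = 0) → a = 0 ∨ b = 0
  finite : Module.Finite R B
  trace_mem : ∀ b : B, regularTrace R b ∈ Set.range (algebraMap R (FractionRing R))

/-- The modified `v`-discriminant ideal `MD_v(B/R)`: the ideal of `R` generated by all
`d_v(U, U') = det (tr(u_i u'_j))`. Families `U, U'` with repeated members are harmless, since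
their determinant vanishes. The elements `d_v(U, U')` are computed in the fraction field; they
lie in `R` when the trace does. -/
def modifiedDiscriminantIdeal (R B : Type*) [CommRing R] [Ring B] [Algebra R B] (v : ℕ) :
    Ideal R :=
  Ideal.span {d : R | ∃ u u' : Fin v → B,
    algebraMap R (FractionRing R) d =
      (Matrix.of fun i j : Fin v => regularTrace R (u i * u' j)).det}

/-- The modified discriminant ideal `MD(B/R) = MD_w(B/R)`, where `w` is the rank of `B`. -/
def MD (R B : Type*) [CommRing R] [Ring B] [Algebra R B] : Ideal R :=
  modifiedDiscriminantIdeal R B (genericRank R B)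

/-- The reflexive hull `M^∨∨` of a submodule `M` of a reflexive module `N`, as a submodule of `N`:
the image of `M^∨∨ → N^∨∨` (bidual of the inclusion), transported along the canonical
isomorphism `N → N^∨∨`. For `R` a domain and `N/M` torsion, `M^∨∨ → N^∨∨` is injective. -/
def reflexiveHull {R N : Type*} [CommRing R] [AddCommGroup N] [Module R N] (M : Submodule R N) :
    Submodule R N :=
  (LinearMap.range M.subtype.dualMap.dualMap).comap (Module.Dual.eval R N)

/-- The `R`-discriminant ideal `(MD(B/R))^∨∨ ⊆ R`. -/
def reflexiveDiscriminantIdeal (R B : Type*) [CommRing R] [Ring B] [Algebra R B] : Ideal R :=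
  reflexiveHull (MD R B)

/-- The extended discriminant ideal `(MD(B/R) B)^∨∨ ⊆ B`. -/
def extendedReflexiveDiscriminantIdeal (R B : Type*) [CommRing R] [Ring B] [Algebra R B] :
    Submodule R B :=
  reflexiveHull (MD R B • (⊤ : Submodule R B))

/-- `d ∈ R` is a reflexive hull discriminant of `B` over `R`. -/
structure IsReflexiveHullDiscriminant (R B : Type*) [CommRing R] [Ring B] [Algebra R B]
    (d : R) : Prop where
  hypothesis : DiscriminantHypothesis R B
  generates : reflexiveDiscriminantIdeal R B = Ideal.span {d}

/-- `d ∈ B` is an extended reflexive hull discriminant of `B` over `R`: `B` is a reflexive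
`R`-module, `d` is normal (`dB = Bd`) and `(MD(B/R) B)^∨∨ = dB`. -/
structure IsExtendedReflexiveHullDiscriminant (R B : Type*) [CommRing R] [Ring B] [Algebra R B]
    (d : B) : Prop where
  hypothesis : DiscriminantHypothesis R B
  reflexive : Module.IsReflexive R B
  normal : Set.range (fun b : B => d * b) = Set.range (fun b : B => b * d)
  generates : (extendedReflexiveDiscriminantIdeal R B : Set B) = Set.range (fun b : B => d * b)

end

end Discriminant

/-! Write `t` for the variable of the base, `W` for the algebra and `Z` for its center. The algebra
`W` embeds into the skew Laurent ring `k[t][X, X⁻¹; σ]` by `x ↦ X`, `y ↦ σ⁻¹(h) X⁻¹`. Its image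
consists of the elements whose coefficient in degree `-m`, for `m > 0`, is divisible by `weight m =
σ⁻¹(h) ⋯ σ⁻ᵐ(h)` (`mem_range_emb_iff`). Hence questions about `W` become questions about
coefficients. As `σ` has order `n`, `q` is a primitive `n`-th root of unity. The central elements
are those with degrees in `nℤ` and coefficients in `k[tⁿ]` (`mem_center_iff`), and this normal form
gives the presentation of `Z` (`ker_aeval`).

Once `a` is inverted, `W` is free over `Z` on the `tⁱ xʲ` with `0 ≤ i, j < n`; once `b` is inverted,
on the `tⁱ yʲ`. For either family, with `g` equal to `x` or `y` and `s = gⁿ`, the regular trace is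
`n²` times the projection to `Z`, and the trace form pairs `tⁱ gʲ` with `gⁿ⁻ʲ tⁿ⁻ⁱ` (with `gⁿ⁻ʲ` if
`i = 0`). The pairing yields `n² s` when `i = 0` and `n² s c` otherwise, so the determinant is a
unit times `s^(n²) c^(n(n-1))`.

The elements `a, b` form a regular pair on `Z` and on `W` (`isRegularPair`): the locus `a = b = 0`
has codimension at least two, and reflexive hulls do not see it. So the two local computations glue.
`W` is reflexive (`DualFamily.isReflexive`); `MD` lies in `(c^(n(n-1)))` (`MD_le_span`) and contains
the products of this generator with powers of `a` and of `b`; and `mem_reflexiveHull_iff` turns this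
into equality of hulls. -/

/-- `a, b` is a regular pair on `N`: every relation `a u = b v` comes from a common `w`. -/
def IsRegularPair {R : Type*} (N : Type*) [SMul R N] (a b : R) : Prop :=
  ∀ u v : N, a • u = b • v → ∃ w : N, u = b • w ∧ v = a • w

namespace IsRegularPair

theorem symm {R N : Type*} [SMul R N] {a b : R} (H : IsRegularPair N a b) :
    IsRegularPair N b a := by
  intro u v huv
  obtain ⟨w, hw⟩ := H v u huv.symm
  exact ⟨w, hw.2, hw.1⟩

theorem pow_left {R N : Type*} [CommMonoid R] [MulAction R N] {a b : R}
    (H : IsRegularPair N a b) (m : ℕ) : IsRegularPair N (a ^ m) b := by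
  induction m with
  | zero => exact fun u v huv => ⟨v, by simpa using huv, by simp⟩
  | succ m ih =>
    intro u v huv
    rw [pow_succ', mul_smul] at huv
    obtain ⟨w, hw, rfl⟩ := H _ _ huv
    obtain ⟨w', rfl, rfl⟩ := ih _ _ hw
    exact ⟨w', rfl, by rw [pow_succ', mul_smul]⟩

theorem pow {R N : Type*} [CommMonoid R] [MulAction R N] {a b : R}
    (H : IsRegularPair N a b) (m l : ℕ) : IsRegularPair N (a ^ m) (b ^ l) :=
  ((H.pow_left m).symm.pow_left l).symm

end IsRegularPair

/-! ### Reflexive hulls computed through a regular pair -/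

section ReflexiveHull

variable {R N : Type*} [CommRing R] [IsDomain R] [AddCommGroup N] [Module R N]

/-- A functional on `M` is evaluated at an element of `N` that two members of a regular pair
multiply into `M`. -/
theorem exists_dual_extension {M : Submodule R N} {α β : R} (hα : α ≠ 0)
    (H : IsRegularPair R α β) {x : N} (hx : α • x ∈ M) (hy : β • x ∈ M) :
    ∃ φ : Module.Dual R (Module.Dual R M), ∀ g, α * φ g = g ⟨α • x, hx⟩ := by
  have key : ∀ g : Module.Dual R M, ∃ w, α * w = g ⟨α • x, hx⟩ := by
    intro g
    -- Both `β * g (αx)` and `α * g (βx)` equal `g (αβx)`, so regularity makes `α` divide `g (αx)`.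
    obtain ⟨w, hw, -⟩ := H.symm (g ⟨α • x, hx⟩) (g ⟨β • x, hy⟩) (by
      rw [← map_smul, ← map_smul]
      congr 1
      ext
      simp [smul_smul, mul_comm])
    exact ⟨w, hw.symm⟩
  choose φ hφ using key
  refine ⟨{ toFun := φ, map_add' := fun f g => ?_, map_smul' := fun r g => ?_ }, hφ⟩
  · apply mul_left_cancel₀ hα
    rw [hφ, mul_add, hφ, hφ, LinearMap.add_apply]
  · apply mul_left_cancel₀ hα
    rw [hφ, RingHom.id_apply, smul_eq_mul, mul_left_comm, hφ, LinearMap.smul_apply, smul_eq_mul]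

/-- The hull is squeezed onto `C N`. Since `M ⊆ C N`, restricting a functional of `N` to `M` gives a
multiple of `C`; dividing a functional on the dual of `M` by `C` then gives an element of the bidual
of `N`, that is, of `N`. Conversely `α` and `β` multiply `C N` into `M`, so every element of `C N`
evaluates functionals on `M`. -/
theorem mem_reflexiveHull_iff [Module.IsReflexive R N] {M : Submodule R N} {α β C : R}
    (hα : α ≠ 0) (hC : C ≠ 0) (H : IsRegularPair R α β)
    (hM : ∀ m ∈ M, ∃ v : N, m = C • v) (hMα : ∀ v : N, α • C • v ∈ M)
    (hMβ : ∀ v : N, β • C • v ∈ M) (x : N) :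
    x ∈ reflexiveHull M ↔ ∃ v : N, x = C • v := by
  have hmem : x ∈ reflexiveHull M ↔ ∃ φ : Module.Dual R (Module.Dual R M),
      ∀ f : Module.Dual R N, φ (f ∘ₗ M.subtype) = f x := by
    simp only [reflexiveHull, Submodule.mem_comap, LinearMap.mem_range]
    refine exists_congr fun φ => ?_
    rw [LinearMap.ext_iff]
    rfl
  rw [hmem]
  constructor
  · rintro ⟨φ, hφ⟩
    have key : ∀ f : Module.Dual R N, ∃ r, C * r = f x := by
      intro f
      have h1 : ∀ m : M, ∃ r, C * r = f m := by
        intro m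
        obtain ⟨v, hv⟩ := hM m m.2
        exact ⟨f v, by rw [hv, map_smul, smul_eq_mul]⟩
      choose g hg using h1
      let g' : Module.Dual R M :=
        { toFun := g
          map_add' := fun m m' => by
            apply mul_left_cancel₀ hC
            rw [hg, mul_add, hg, hg]; simp
          map_smul' := fun r m => by
            apply mul_left_cancel₀ hC
            rw [hg, RingHom.id_apply, smul_eq_mul, mul_left_comm, hg]; simp }
      have h2 : f ∘ₗ M.subtype = C • g' := by
        ext m
        exact (hg m).symm
      exact ⟨φ g', by rw [← hφ, h2, map_smul, smul_eq_mul]⟩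
    choose ψ hψ using key
    let ψ' : Module.Dual R (Module.Dual R N) :=
      { toFun := ψ
        map_add' := fun f f' => by
          apply mul_left_cancel₀ hC
          rw [hψ, mul_add, hψ, hψ]; simp
        map_smul' := fun r f => by
          apply mul_left_cancel₀ hC
          rw [hψ, RingHom.id_apply, smul_eq_mul, mul_left_comm, hψ]; simp }
    obtain ⟨v, hv⟩ := (Module.bijective_dual_eval R N).2 ψ'
    refine ⟨v, (Module.bijective_dual_eval R N).1 ?_⟩
    ext f
    have h3 : f v = ψ f := LinearMap.congr_fun hv f
    simp [← hψ, h3]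
  · rintro ⟨v, rfl⟩
    obtain ⟨φ, hφ⟩ := exists_dual_extension hα H (hMα v) (hMβ v)
    refine ⟨φ, fun f => mul_left_cancel₀ hα ?_⟩
    rw [hφ]
    simp

end ReflexiveHull

/-! ### Bases up to a denominator: trace, determinants, reflexivity -/

/-- A family `e` of elements of `B` together with linear functionals that, up to the factor `s`,
behave like a basis and its dual basis. -/
structure DualFamily {R : Type*} (B : Type*) [CommRing R] [Ring B] [Algebra R B] (s : R)
    (ι : Type*) [Fintype ι] [DecidableEq ι] where
  /-- the members of the family -/
  e : ι → B
  /-- the dual functionals -/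
  coord : ι → B →ₗ[R] R
  sum_coord : ∀ b, ∑ i, coord i b • e i = s • b
  coord_e : ∀ i j, coord i (e j) = if i = j then s else 0

namespace DualFamily

noncomputable section

variable {R B : Type*} [CommRing R] [IsDomain R] [Ring B] [Algebra R B] {s : R}
  {ι : Type*} [Fintype ι] [DecidableEq ι] (D : DualFamily B s ι)

/-- The functional on the generic fibre induced by `coord i`. -/
def fracCoord (i : ι) : FractionRing R ⊗[R] B →ₗ[FractionRing R] FractionRing R :=
  (TensorProduct.AlgebraTensorModule.rid R (FractionRing R) (FractionRing R)).toLinearMap ∘ₗ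
    (D.coord i).baseChange (FractionRing R)

omit [IsDomain R] in
@[simp] theorem fracCoord_tmul (i : ι) (f : FractionRing R) (b : B) :
    D.fracCoord i (f ⊗ₜ b) = f * algebraMap R (FractionRing R) (D.coord i b) := by
  simp [fracCoord, Algebra.smul_def, mul_comm]

/-- A dual family with `s ≠ 0` gives a basis of the generic fibre. -/
def basis (hs : s ≠ 0) : Module.Basis ι (FractionRing R) (FractionRing R ⊗[R] B) :=
  have hs' : algebraMap R (FractionRing R) s ≠ 0 := by simpa using hs
  Module.Basis.ofEquivFun
    { toFun := fun v i => (algebraMap R (FractionRing R) s)⁻¹ * D.fracCoord i v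
      invFun := fun f => ∑ i, f i • ((1 : FractionRing R) ⊗ₜ[R] D.e i)
      map_add' := fun v w => by ext i; simp [mul_add]
      map_smul' := fun r v => by ext i; simp [mul_left_comm]
      left_inv := fun v => by
        induction v with
        | zero => simp
        | add v w hv hw =>
          simp only [map_add, mul_add, add_smul, Finset.sum_add_distrib] at hv hw ⊢
          rw [hv, hw]
        | tmul f b =>
          have h1 : ∀ i, ((algebraMap R (FractionRing R) s)⁻¹ * D.fracCoord i (f ⊗ₜ[R] b)) •
              ((1 : FractionRing R) ⊗ₜ[R] D.e i) =
              ((algebraMap R (FractionRing R) s)⁻¹ * f) ⊗ₜ[R] (D.coord i b • D.e i) := by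
            intro i
            rw [← TensorProduct.smul_tmul, TensorProduct.smul_tmul', fracCoord_tmul]
            congr 1
            simp only [Algebra.smul_def, Algebra.algebraMap_self, RingHom.id_apply, mul_one]
            ring
          simp only [h1]
          rw [← TensorProduct.tmul_sum, D.sum_coord, ← TensorProduct.smul_tmul]
          congr 1
          rw [Algebra.smul_def]
          field_simp
      right_inv := fun f => by
        ext i
        simp only [map_sum, map_smul, fracCoord_tmul, D.coord_e, smul_eq_mul, one_mul]
        rw [Finset.sum_eq_single i]
        · simp only [if_true]
          field_simp
        · intro j _ hj
          simp [hj.symm]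
        · simp }

@[simp] theorem basis_apply (hs : s ≠ 0) (i : ι) : D.basis hs i = 1 ⊗ₜ[R] D.e i := by
  classical
  rw [basis, Module.Basis.coe_ofEquivFun]
  change ∑ j, (Pi.single i (1 : FractionRing R) : ι → FractionRing R) j •
    ((1 : FractionRing R) ⊗ₜ[R] D.e j) = _
  rw [Finset.sum_eq_single i] <;> simp +contextual

theorem basis_repr (hs : s ≠ 0) (v : FractionRing R ⊗[R] B) (i : ι) :
    (D.basis hs).repr v i = (algebraMap R (FractionRing R) s)⁻¹ * D.fracCoord i v := by
  rw [basis, Module.Basis.ofEquivFun_repr_apply]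
  rfl

include D in
theorem genericRank_eq (hs : s ≠ 0) : genericRank R B = Fintype.card ι :=
  Module.finrank_eq_card_basis (D.basis hs)

/-- In the basis `1 ⊗ e i`, the diagonal entries of left multiplication by `b` are `coord i (b * e
i) / s`. -/
theorem regularTrace_eq (hs : s ≠ 0) {b : B} {r : R}
    (h : s * r = ∑ i, D.coord i (b * D.e i)) :
    regularTrace R b = algebraMap R (FractionRing R) r := by
  have hs' : algebraMap R (FractionRing R) s ≠ 0 := by simpa using hs
  rw [regularTrace, LinearMap.trace_eq_matrix_trace _ (D.basis hs), Matrix.trace]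
  simp only [Matrix.diag_apply, LinearMap.toMatrix_apply, basis_apply, LinearMap.mulLeft_apply,
    Algebra.TensorProduct.tmul_mul_tmul, one_mul, basis_repr, fracCoord_tmul]
  rw [← Finset.mul_sum, ← map_sum, ← h, map_mul]
  field_simp

omit [IsDomain R] in
-- Expanding `s • u i` in the family factors the scaled Gram matrix as the coordinate matrix of `u`
-- times a Gram matrix with left entries in the family.
theorem pow_mul_det (T : B →ₗ[R] R) {κ : Type*} [Fintype κ] [DecidableEq κ] (f : κ ≃ ι)
    (u u' : κ → B) :
    s ^ Fintype.card ι * (Matrix.of fun i j => T (u i * u' j)).det =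
      (Matrix.of fun i j => D.coord (f j) (u i)).det *
        (Matrix.of fun i j => T (D.e (f i) * u' j)).det := by
  rw [← Matrix.det_mul, ← Fintype.card_congr f, ← Matrix.det_smul]
  congr 1
  ext i j
  simp only [Matrix.smul_apply, Matrix.of_apply, Matrix.mul_apply, smul_eq_mul]
  rw [← smul_eq_mul, ← map_smul, ← smul_mul_assoc, ← D.sum_coord, Finset.sum_mul, map_sum,
    ← f.sum_comp]
  exact Finset.sum_congr rfl fun l _ => by rw [smul_mul_assoc, map_smul, smul_eq_mul]

include D in
/-- The reflexivity criterion: two dual families whose denominators form a regular pair. -/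
theorem isReflexive [Module.IsTorsionFree R B] {s' : R} (D' : DualFamily B s' ι) (hs : s ≠ 0)
    (H : IsRegularPair B s s') : Module.IsReflexive R B := by
  have inj : ∀ w w' : B, (∀ f : Module.Dual R B, f w = f w') → w = w' := by
    intro w w' hw
    apply smul_right_injective B hs
    change s • w = s • w'
    rw [← D.sum_coord, ← D.sum_coord]
    exact Finset.sum_congr rfl fun i _ => by rw [hw]
  have key : ∀ {s : R} (D : DualFamily B s ι) (φ : Module.Dual R (Module.Dual R B)),
      ∃ w : B, ∀ f, s * φ f = f w := by
    intro s D φ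
    -- The expansion `s • f = ∑ f (e i) • coord i` shows that this element represents `s φ`.
    refine ⟨∑ i, φ (D.coord i) • D.e i, fun f => ?_⟩
    have h1 : s • f = ∑ i, f (D.e i) • D.coord i := by
      ext b
      rw [LinearMap.smul_apply, ← map_smul, ← D.sum_coord]
      simp [mul_comm]
    rw [← smul_eq_mul, ← map_smul, h1]
    simp [mul_comm]
  refine ⟨⟨fun w w' hw => inj _ _ fun f => LinearMap.congr_fun hw f, fun φ => ?_⟩⟩
  obtain ⟨w, hw⟩ := key D φ
  obtain ⟨w', hw'⟩ := key D' φ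
  -- Here `w` represents `s φ` and `w'` represents `s' φ`, so `s w' = s' w`; regularity gives `w = s
  -- v`, and `v` represents `φ`.
  obtain ⟨v, -, hv⟩ := H w' w (inj _ _ fun f => by
    rw [map_smul, map_smul, ← hw, ← hw', smul_eq_mul, smul_eq_mul, mul_left_comm])
  refine ⟨v, ?_⟩
  ext f
  apply mul_left_cancel₀ hs
  rw [hw, hv, map_smul, smul_eq_mul, Module.Dual.eval_apply]

end

end DualFamily

/-! ### Bounds for the modified discriminant ideal -/

section DiscriminantIdeal

variable {R B : Type*} [CommRing R] [IsDomain R] [Ring B] [Algebra R B]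
  {ι : Type*} [Fintype ι] [DecidableEq ι]

omit [IsDomain R] in
theorem det_regularTrace_eq {T : B →ₗ[R] R}
    (hT : ∀ b, regularTrace R b = algebraMap R (FractionRing R) (T b)) {κ : Type*} [Fintype κ]
    [DecidableEq κ] (u u' : κ → B) :
    (Matrix.of fun i j => regularTrace R (u i * u' j)).det =
      algebraMap R (FractionRing R) (Matrix.of fun i j => T (u i * u' j)).det := by
  rw [RingHom.map_det]
  congr 1
  ext i j
  simp [hT]

omit [IsDomain R] in
theorem det_mem_MD {T : B →ₗ[R] R}
    (hT : ∀ b, regularTrace R b = algebraMap R (FractionRing R) (T b))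
    (hι : genericRank R B = Fintype.card ι) (u u' : ι → B) :
    (Matrix.of fun i j => T (u i * u' j)).det ∈ MD R B := by
  let f : Fin (genericRank R B) ≃ ι := (finCongr hι).trans (Fintype.equivFin ι).symm
  refine Ideal.subset_span ⟨u ∘ f, u' ∘ f, ?_⟩
  rw [det_regularTrace_eq hT, ← Matrix.det_submatrix_equiv_self f]
  rfl

/-- The upper bound for the modified discriminant ideal given by two dual families. -/
theorem MD_le_span {T : B →ₗ[R] R}
    (hT : ∀ b, regularTrace R b = algebraMap R (FractionRing R) (T b)) {s s' : R}
    (D : DualFamily B s ι) (D' : DualFamily B s' ι) (hs : s ≠ 0)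
    (H : IsRegularPair R s s') {c : ι → R} (hc : ∀ i, c i ≠ 0)
    (hD : ∀ i u, c i ∣ T (D.e i * u)) (hD' : ∀ i u, c i ∣ T (D'.e i * u)) :
    MD R B ≤ Ideal.span {∏ i, c i} := by
  have hC : ∏ i, c i ≠ 0 := Finset.prod_ne_zero_iff.2 fun i _ => hc i
  have hι := D.genericRank_eq hs
  let f : Fin (genericRank R B) ≃ ι := (finCongr hι).trans (Fintype.equivFin ι).symm
  have key : ∀ {s : R} (D : DualFamily B s ι) (_ : ∀ i u, c i ∣ T (D.e i * u))
      (u u' : Fin (genericRank R B) → B), ∃ r, s ^ Fintype.card ι *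
        (Matrix.of fun i j => T (u i * u' j)).det = (∏ i, c i) * r := by
    intro s D hD u u'
    choose r hr using hD
    have h1 : (Matrix.of fun i j => T (D.e (f i) * u' j)) =
        Matrix.of fun i j => c (f i) * (Matrix.of fun i j => r (f i) (u' j)) i j := by
      ext i j
      exact hr _ _
    rw [D.pow_mul_det T f, h1, Matrix.det_mul_column, f.prod_comp c, mul_left_comm]
    exact ⟨_, rfl⟩
  refine Ideal.span_le.2 ?_
  rintro d ⟨u, u', hd⟩
  rw [det_regularTrace_eq hT] at hd
  have hd' := FaithfulSMul.algebraMap_injective R (FractionRing R) hd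
  obtain ⟨r, hr⟩ := key D hD u u'
  obtain ⟨r', hr'⟩ := key D' hD' u u'
  rw [← hd'] at hr hr'
  -- With `N` the size of the family, `s ^ N * d` and `s' ^ N * d` are multiples of the product of
  -- the `c i`, with quotients `r` and `r'`. Hence `s ^ N * r' = s' ^ N * r`, and regularity of the
  -- powers removes the denominator.
  obtain ⟨w, -, hw⟩ := H.pow (Fintype.card ι) (Fintype.card ι) r' r (by
    apply mul_left_cancel₀ hC
    rw [smul_eq_mul, smul_eq_mul, mul_left_comm, ← hr', mul_left_comm _ _ r, ← hr]
    ring)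
  refine Ideal.mem_span_singleton.2 ⟨w, ?_⟩
  apply mul_left_cancel₀ (pow_ne_zero (Fintype.card ι) hs)
  rw [hr, hw, smul_eq_mul]
  ring

end DiscriminantIdeal

/-! ### The skew Laurent ring -/

section SkewLaurent

variable {k R : Type*} [CommRing k] [CommRing R] [Algebra k R] (σ : R ≃ₐ[k] R)

/-- The infinite cyclic group (written multiplicatively), acting on `R` through `σ`. -/
def ShiftGroup (_ : R ≃ₐ[k] R) : Type := Multiplicative ℤ

namespace ShiftGroup

instance instCommGroup : CommGroup (ShiftGroup σ) := inferInstanceAs (CommGroup (Multiplicative ℤ))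

instance instAction : MulSemiringAction (ShiftGroup σ) R :=
  MulSemiringAction.compHom R (zpowersHom (R ≃ₐ[k] R) σ)

/-- The integer `i` as an element of the group. -/
def of (i : ℤ) : ShiftGroup σ := Multiplicative.ofAdd i

/-- The group is the group of integers. -/
def toInt : ShiftGroup σ ≃ ℤ := Multiplicative.toAdd

theorem of_smul (i : ℤ) (r : R) : of σ i • r = (σ ^ i) r := rfl

instance instSMulCommClass : SMulCommClass (ShiftGroup σ) k R where
  smul_comm g c r := map_smul (σ ^ (toInt σ g)) c r

end ShiftGroup

/-- The skew Laurent polynomial ring `R[X, X⁻¹; σ]`. -/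
abbrev SkewLaurent := SkewMonoidAlgebra R (ShiftGroup σ)

namespace SkewLaurent

/-- The monomial `r X ^ i`. -/
noncomputable def term (i : ℤ) (r : R) : SkewLaurent σ := SkewMonoidAlgebra.single (ShiftGroup.of σ i) r

/-- The coefficients. -/
noncomputable def cf : SkewLaurent σ ≃+ (ℤ →₀ R) :=
  SkewMonoidAlgebra.coeffAddEquiv.trans (Finsupp.domCongr (ShiftGroup.toInt σ))

variable {σ}

theorem cf_apply (s : SkewLaurent σ) (i : ℤ) : cf σ s i = s.coeff (ShiftGroup.of σ i) := rfl

theorem ext_cf {s s' : SkewLaurent σ} (H : ∀ i, cf σ s i = cf σ s' i) : s = s' :=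
  (cf σ).injective (Finsupp.ext H)

theorem cf_term (i : ℤ) (r : R) (j : ℤ) : cf σ (term σ i r) j = if i = j then r else 0 := by
  classical
  rw [cf_apply, term, SkewMonoidAlgebra.coeff_single_apply]
  exact if_congr Iff.rfl rfl rfl

theorem term_add (i : ℤ) (r r' : R) : term σ i (r + r') = term σ i r + term σ i r' :=
  SkewMonoidAlgebra.single_add _ _ _

theorem term_one : term σ 0 (1 : R) = 1 := rfl

theorem algebraMap_eq_term (c : k) : algebraMap k (SkewLaurent σ) c = term σ 0 (algebraMap k R c) := rfl

theorem term_mul_term (i j : ℤ) (r r' : R) :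
    term σ i r * term σ j r' = term σ (i + j) (r * (σ ^ i) r') :=
  SkewMonoidAlgebra.single_mul_single

theorem cf_mul_term (s : SkewLaurent σ) (j : ℤ) (r : R) (i : ℤ) :
    cf σ (s * term σ j r) i = cf σ s (i - j) * (σ ^ (i - j)) r := by
  rw [cf_apply, term, SkewMonoidAlgebra.coeff_mul_single]
  rfl

theorem cf_term_mul (s : SkewLaurent σ) (j : ℤ) (r : R) (i : ℤ) :
    cf σ (term σ j r * s) i = r * (σ ^ j) (cf σ s (i - j)) := by
  rw [cf_apply, term, SkewMonoidAlgebra.coeff_single_mul, ← ShiftGroup.of_smul, cf_apply,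
    sub_eq_neg_add]
  rfl

theorem cf_mul (s s' : SkewLaurent σ) (i : ℤ) :
    cf σ (s * s') i = (cf σ s).sum fun j r => r * (σ ^ j) (cf σ s' (i - j)) := by
  rw [cf_apply, SkewMonoidAlgebra.coeff_mul_left, SkewMonoidAlgebra.sum_def]
  refine Eq.trans (Finsupp.sum_congr fun g _ => ?_)
    (Finsupp.sum_equivMapDomain (ShiftGroup.toInt σ) s.coeff
      fun j r => r * (σ ^ j) (cf σ s' (i - j))).symm
  simp only [← ShiftGroup.of_smul, cf_apply, sub_eq_neg_add]
  rfl

theorem cf_mul' (s s' : SkewLaurent σ) (i : ℤ) :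
    cf σ (s * s') i = (cf σ s').sum fun j r => cf σ s (i - j) * (σ ^ (i - j)) r := by
  rw [cf_apply, SkewMonoidAlgebra.coeff_mul_right, SkewMonoidAlgebra.sum_def]
  exact (Finsupp.sum_equivMapDomain (ShiftGroup.toInt σ) s'.coeff
    fun j r => cf σ s (i - j) * (σ ^ (i - j)) r).symm

/-- The top coefficient of a product is the product of the top coefficients, the second one twisted
by an injective power of `σ`. -/
instance instNoZeroDivisors [NoZeroDivisors R] : NoZeroDivisors (SkewLaurent σ) where
  eq_zero_or_eq_zero_of_mul_eq_zero := by
    intro s s' H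
    by_contra! hne
    have hs : (cf σ s).support.Nonempty := by simpa using hne.1
    have hs' : (cf σ s').support.Nonempty := by simpa using hne.2
    set i := (cf σ s).support.max' hs with hi
    set j := (cf σ s').support.max' hs' with hj
    have h1 : cf σ s i ≠ 0 := Finsupp.mem_support_iff.1 (Finset.max'_mem _ hs)
    have h2 : cf σ s' j ≠ 0 := Finsupp.mem_support_iff.1 (Finset.max'_mem _ hs')
    have h3 : cf σ (s * s') (i + j) = cf σ s i * (σ ^ i) (cf σ s' j) := by
      rw [cf_mul, Finsupp.sum, Finset.sum_eq_single i]
      · rw [add_sub_cancel_left]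
      · intro l hl hli
        have hl' : l < i := lt_of_le_of_ne (Finset.le_max' _ _ hl) hli
        have : cf σ s' (i + j - l) = 0 := by
          by_contra hc
          have := Finset.le_max' _ _ (Finsupp.mem_support_iff.2 hc)
          omega
        rw [this, map_zero, mul_zero]
      · exact fun hc => absurd (Finset.max'_mem _ hs) hc
    rw [H, map_zero, Finsupp.zero_apply] at h3
    exact mul_ne_zero h1 ((map_ne_zero_iff _ (σ ^ i).injective).2 h2) h3.symm

end SkewLaurent

end SkewLaurent

/-! ### Normal form of the Weyl algebra inside the skew Laurent ring -/

namespace GWA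

open SkewLaurent

section Relations

variable {k R : Type*} [CommRing k] [Ring R] [Algebra k R] (σ : R ≃ₐ[k] R) (h : R)

theorem x_mul_y : x σ h * y σ h = ofBase σ h h :=
  (map_mul (mk σ h) _ _).symm.trans (mk_eq_of_rel σ h GWARel.xy)

theorem y_mul_x : y σ h * x σ h = ofBase σ h (σ.symm h) :=
  (map_mul (mk σ h) _ _).symm.trans (mk_eq_of_rel σ h GWARel.yx)

theorem x_mul_ofBase (r : R) : x σ h * ofBase σ h r = ofBase σ h (σ r) * x σ h :=
  (map_mul (mk σ h) _ _).symm.trans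
    ((mk_eq_of_rel σ h (GWARel.xr r)).trans (map_mul (mk σ h) _ _))

theorem y_mul_ofBase (r : R) : y σ h * ofBase σ h r = ofBase σ h (σ.symm r) * y σ h :=
  (map_mul (mk σ h) _ _).symm.trans
    ((mk_eq_of_rel σ h (GWARel.yr r)).trans (map_mul (mk σ h) _ _))

/-- The monomial `x ^ i` for `i ≥ 0` and `y ^ (-i)` for `i < 0`. -/
def v (i : ℤ) : GWA k σ h := if 0 ≤ i then x σ h ^ i.toNat else y σ h ^ (-i).toNat

theorem v_natCast (m : ℕ) : v σ h m = x σ h ^ m := by simp [v]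

theorem v_neg_natCast (m : ℕ) : v σ h (-m) = y σ h ^ m := by
  rcases Nat.eq_zero_or_pos m with rfl | hm
  · simp [v]
  · rw [v, if_neg (by omega)]
    simp

theorem exists_x_mul_v (i : ℤ) : ∃ r, x σ h * v σ h i = ofBase σ h r * v σ h (i + 1) := by
  rcases Int.le_total 0 i with hi | hi
  · obtain ⟨m, rfl⟩ := Int.eq_ofNat_of_zero_le hi
    refine ⟨1, ?_⟩
    rw [v_natCast, map_one, one_mul, ← pow_succ', ← v_natCast]
    rfl
  · obtain ⟨m, rfl⟩ : ∃ m : ℕ, i = -m := ⟨(-i).toNat, by omega⟩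
    rcases m with _ | m
    · exact ⟨1, by simp [v]⟩
    · refine ⟨h, ?_⟩
      rw [v_neg_natCast, pow_succ', ← mul_assoc, x_mul_y, ← v_neg_natCast]
      congr 2
      push_cast
      ring

theorem exists_y_mul_v (i : ℤ) : ∃ r, y σ h * v σ h i = ofBase σ h r * v σ h (i - 1) := by
  rcases Int.le_total 0 i with hi | hi
  · obtain ⟨m, rfl⟩ := Int.eq_ofNat_of_zero_le hi
    rcases m with _ | m
    · exact ⟨1, by simp [v]⟩
    · refine ⟨σ.symm h, ?_⟩
      rw [v_natCast, pow_succ', ← mul_assoc, y_mul_x, ← v_natCast]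
      congr 2
      push_cast
      ring
  · obtain ⟨m, rfl⟩ : ∃ m : ℕ, i = -m := ⟨(-i).toNat, by omega⟩
    refine ⟨1, ?_⟩
    rw [v_neg_natCast, map_one, one_mul, ← pow_succ', ← v_neg_natCast]
    congr 1
    push_cast
    ring

/-- The element with prescribed coefficients in the monomials `v i`. -/
noncomputable def combination : (ℤ →₀ R) →+ GWA k σ h :=
  Finsupp.liftAddHom fun i => (AddMonoidHom.mulRight (v σ h i)).comp (ofBase σ h : R →+ GWA k σ h)

theorem combination_single (i : ℤ) (r : R) :
    combination σ h (Finsupp.single i r) = ofBase σ h r * v σ h i := by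
  simp [combination]

/-- The image contains `1` and is stable under left multiplication by every generator of the free
algebra. -/
theorem combination_surjective : Function.Surjective (combination σ h) := by
  have key : ∀ u : FreeAlgebra k (R ⊕ Bool), ∀ g, ∃ g',
      combination σ h g' = mk σ h u * combination σ h g := by
    intro u
    have single : ∀ u' : GWA k σ h, (∀ i r, ∃ g', combination σ h g' =
        u' * (ofBase σ h r * v σ h i)) → ∀ g, ∃ g', combination σ h g' =
        u' * combination σ h g := by
      intro u' hu g
      induction g using Finsupp.induction_linear with
      | zero => exact ⟨0, by simp⟩
      | add g₁ g₂ h₁ h₂ =>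
        obtain ⟨g₁', h₁⟩ := h₁
        obtain ⟨g₂', h₂⟩ := h₂
        exact ⟨g₁' + g₂', by rw [map_add, h₁, h₂, map_add, mul_add]⟩
      | single i r =>
        rw [combination_single]
        exact hu i r
    have base : ∀ r g, ∃ g', combination σ h g' = ofBase σ h r * combination σ h g := by
      refine fun r => single _ fun i r' => ⟨Finsupp.single i (r * r'), ?_⟩
      rw [combination_single, map_mul, mul_assoc]
    induction u using FreeAlgebra.induction with
    | grade0 c =>
      intro g
      obtain ⟨g', hg'⟩ := base (algebraMap k R c) g
      exact ⟨g', by rw [hg', AlgHom.commutes, AlgHom.commutes]⟩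
    | grade1 z =>
      rcases z with r | (_ | _)
      · exact base r
      · refine single _ fun i r => ?_
        obtain ⟨r', hr'⟩ := exists_y_mul_v σ h i
        refine ⟨Finsupp.single (i - 1) (σ.symm r * r'), ?_⟩
        change _ = y σ h * _
        rw [combination_single, ← mul_assoc, y_mul_ofBase, mul_assoc, hr', map_mul, mul_assoc]
      · refine single _ fun i r => ?_
        obtain ⟨r', hr'⟩ := exists_x_mul_v σ h i
        refine ⟨Finsupp.single (i + 1) (σ r * r'), ?_⟩
        change _ = x σ h * _
        rw [combination_single, ← mul_assoc, x_mul_ofBase, mul_assoc, hr', map_mul, mul_assoc]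
    | mul u u' hu hu' =>
      intro g
      obtain ⟨g₁, h₁⟩ := hu' g
      obtain ⟨g₂, h₂⟩ := hu g₁
      exact ⟨g₂, by rw [h₂, h₁, map_mul, mul_assoc]⟩
    | add u u' hu hu' =>
      intro g
      obtain ⟨g₁, h₁⟩ := hu g
      obtain ⟨g₂, h₂⟩ := hu' g
      exact ⟨g₁ + g₂, by rw [map_add, h₁, h₂, map_add, add_mul]⟩
  intro w
  obtain ⟨u, rfl⟩ := RingQuot.mkAlgHom_surjective k (GWARel k σ h) w
  obtain ⟨g, hg⟩ := key u (Finsupp.single 0 1)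
  refine ⟨g, ?_⟩
  rw [hg, combination_single]
  simp [v]
  rfl

end Relations

variable {k R : Type*} [CommRing k] [CommRing R] [Algebra k R] (σ : R ≃ₐ[k] R) (h : R)

/-- The embedding into the skew Laurent ring: `x ↦ X` and `y ↦ X⁻¹ h`. -/
noncomputable def emb : GWA k σ h →ₐ[k] SkewLaurent σ :=
  RingQuot.liftAlgHom k (s := GWARel k σ h) ⟨FreeAlgebra.lift k fun z =>
    Sum.elim (fun r => term σ 0 r)
      (fun b => if b then term σ 1 1 else term σ (-1) (σ.symm h)) z, by
    intro u w H
    cases H <;>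
      simp [term_add, term_mul_term, algebraMap_eq_term, mul_comm,
        -SkewMonoidAlgebra.coe_algebraMap]⟩

theorem emb_mk (z : R ⊕ Bool) : emb σ h (mk σ h (FreeAlgebra.ι k z)) =
    Sum.elim (fun r => term σ 0 r)
      (fun b => if b then term σ 1 1 else term σ (-1) (σ.symm h)) z := by
  rw [emb, mk]
  erw [RingQuot.liftAlgHom_mkAlgHom_apply]
  rw [FreeAlgebra.lift_ι_apply]

@[simp] theorem emb_ofBase (r : R) : emb σ h (ofBase σ h r) = term σ 0 r := emb_mk σ h (Sum.inl r)

@[simp] theorem emb_x : emb σ h (x σ h) = term σ 1 1 := emb_mk σ h (Sum.inr true)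

@[simp] theorem emb_y : emb σ h (y σ h) = term σ (-1) (σ.symm h) := emb_mk σ h (Sum.inr false)

/-- The coefficient of `X ^ (-m)` in the image of `y ^ m`. -/
def weight (m : ℕ) : R := ∏ j ∈ Finset.range m, (σ ^ (-((j : ℤ) + 1))) h

theorem weight_zero : weight σ h 0 = 1 := Finset.prod_range_zero _

theorem weight_succ (m : ℕ) : weight σ h (m + 1) = weight σ h m * (σ ^ (-((m : ℤ) + 1))) h :=
  Finset.prod_range_succ _ _

theorem weight_add (m l : ℕ) :
    weight σ h (m + l) = weight σ h m * (σ ^ (-(m : ℤ))) (weight σ h l) := by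
  rw [weight, Finset.prod_range_add, weight, weight, map_prod]
  congr 1
  refine Finset.prod_congr rfl fun j _ => ?_
  rw [← AlgEquiv.mul_apply, ← zpow_add]
  congr 2
  push_cast
  ring

theorem emb_x_pow (m : ℕ) : emb σ h (x σ h ^ m) = term σ m 1 := by
  induction m with
  | zero => simp [term_one]
  | succ m ih => rw [pow_succ, map_mul, ih, emb_x, term_mul_term]; simp

theorem emb_y_pow (m : ℕ) : emb σ h (y σ h ^ m) = term σ (-m) (weight σ h m) := by
  induction m with
  | zero => simp [term_one, weight_zero]
  | succ m ih =>
    rw [pow_succ, map_mul, ih, emb_y, term_mul_term, weight_succ]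
    congr 1
    · push_cast; ring
    · congr 1
      change (σ ^ (-(m : ℤ))) ((σ ^ (-1 : ℤ)) h) = _
      rw [← AlgEquiv.mul_apply, ← zpow_add]
      congr 2
      ring

theorem emb_v (i : ℤ) : emb σ h (v σ h i) = term σ i (weight σ h (-i).toNat) := by
  rcases Int.le_total 0 i with hi | hi
  · obtain ⟨m, rfl⟩ := Int.eq_ofNat_of_zero_le hi
    rw [v_natCast, emb_x_pow]
    congr 1
    rw [Int.toNat_neg_natCast, weight_zero]
  · obtain ⟨m, rfl⟩ : ∃ m : ℕ, i = -m := ⟨(-i).toNat, by omega⟩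
    rw [v_neg_natCast, emb_y_pow]
    simp

theorem cf_emb_combination (g : ℤ →₀ R) (i : ℤ) :
    cf σ (emb σ h (combination σ h g)) i = g i * weight σ h (-i).toNat := by
  induction g using Finsupp.induction_linear with
  | zero => simp
  | add g₁ g₂ h₁ h₂ => simp [h₁, h₂, add_mul]
  | single j r =>
    rw [combination_single, map_mul, emb_ofBase, emb_v, term_mul_term, zero_add, cf_term,
      Finsupp.single_apply]
    split_ifs with hij
    · subst hij; simp
    · simp

/-- The embedding is diagonal on the monomials `v i`, so membership is tested degree by degree. It
is no condition in degrees `≥ 0`, where the weight is `1`. -/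
theorem mem_range_emb_iff (s : SkewLaurent σ) :
    s ∈ Set.range (emb σ h) ↔ ∀ i, weight σ h (-i).toNat ∣ cf σ s i := by
  constructor
  · rintro ⟨w, rfl⟩ i
    obtain ⟨g, rfl⟩ := combination_surjective σ h w
    rw [cf_emb_combination]
    exact Dvd.intro_left _ rfl
  · intro H
    classical
    choose g hg using H
    refine ⟨combination σ h (Finsupp.onFinset (cf σ s).support
      (fun i => if cf σ s i = 0 then 0 else g i) (by simp +contextual)),
      ext_cf fun i => ?_⟩
    rw [cf_emb_combination, Finsupp.onFinset_apply]
    split_ifs with h0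
    · rw [h0, zero_mul]
    · rw [hg i, mul_comm]

section Domain

variable {h} [IsDomain R] (hh : h ≠ 0)

include hh

theorem weight_ne_zero (m : ℕ) : weight σ h m ≠ 0 :=
  Finset.prod_ne_zero_iff.2 fun _ _ => (map_ne_zero_iff _ (AlgEquiv.injective _)).2 hh

/-- Each coefficient of a combination is recovered from its image because the weights are nonzero.
With surjectivity this makes the `v i` a basis over the base ring. -/
theorem emb_injective : Function.Injective (emb σ h) := by
  refine (injective_iff_map_eq_zero _).2 fun w hw => ?_
  obtain ⟨g, rfl⟩ := combination_surjective σ h w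
  suffices g = 0 by rw [this, map_zero]
  ext i
  have := cf_emb_combination σ h g i
  rw [hw, map_zero, Finsupp.zero_apply] at this
  exact (mul_eq_zero.1 this.symm).resolve_right (weight_ne_zero σ hh _)

protected theorem isDomain : IsDomain (GWA k σ h) := by
  have h1 := (emb_injective σ hh).noZeroDivisors (emb σ h) (map_zero _) (map_mul _)
  have h2 : Nontrivial (GWA k σ h) := by
    refine ⟨0, 1, fun H => ?_⟩
    have := congrArg (fun w => cf σ (emb σ h w) 0) H
    simp [← term_one, cf_term] at this
  exact NoZeroDivisors.to_isDomain _

end Domain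

end GWA

/-! ### Polynomials as a free module over polynomials in `X ^ n` -/

section Residue

variable {k : Type*} [CommRing k]

/-- The part of `f` supported in degrees congruent to `i` modulo `n`, divided by `X ^ i`. -/
noncomputable def residue (n i : ℕ) : k[X] →+ k[X] :=
  if hn : 0 < n then
    { toFun := fun f => expand k n (contract n (divX^[i] f))
      map_zero' := by
        have : (divX^[i] (0 : k[X])) = 0 := by
          induction i with
          | zero => rfl
          | succ i ih => rw [Function.iterate_succ_apply', ih, divX_zero]
        ext m
        simp [coeff_expand hn, coeff_contract hn.ne', this]
      map_add' := fun f g => by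
        have : ∀ j, (divX^[j] (f + g)) = divX^[j] f + divX^[j] g := by
          intro j
          induction j with
          | zero => rfl
          | succ j ih =>
            rw [Function.iterate_succ_apply', ih, divX_add, Function.iterate_succ_apply',
              Function.iterate_succ_apply']
        rw [this]
        ext m
        simp only [coeff_expand hn, coeff_contract hn.ne', coeff_add]
        split_ifs <;> simp }
  else 0

theorem coeff_residue {n : ℕ} (hn : 0 < n) (i : ℕ) (f : k[X]) (m : ℕ) :
    (residue n i f).coeff m = if n ∣ m then f.coeff (m + i) else 0 := by
  have h1 : ∀ j l (g : k[X]), (divX^[j] g).coeff l = g.coeff (l + j) := by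
    intro j
    induction j with
    | zero => simp
    | succ j ih =>
      intro l g
      rw [Function.iterate_succ_apply, ih, coeff_divX, add_assoc]
  rw [residue, dif_pos hn]
  change (expand k n (contract n (divX^[i] f))).coeff m = _
  rw [coeff_expand hn]
  split_ifs with hm
  · rw [coeff_contract hn.ne', h1, Nat.div_mul_cancel hm]
  · rfl

theorem residue_eq_expand {n : ℕ} (hn : 0 < n) (i : ℕ) (f : k[X]) :
    residue n i f = expand k n (contract n (residue n i f)) := by
  ext m
  rw [coeff_expand hn, coeff_contract hn.ne']
  split_ifs with hm
  · rw [Nat.div_mul_cancel hm]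
  · rw [coeff_residue hn, if_neg hm]

/-- Multiplication by `X ^ (l * n)` preserves classes modulo `n`. The bound `i < n` matters:
`residue` discards degrees below `i`, and no degree of the class of `i` is lost. -/
theorem residue_expand_mul {n i : ℕ} (hi : i < n) (g f : k[X]) :
    residue n i (expand k n g * f) = expand k n g * residue n i f := by
  have hn : 0 < n := by omega
  induction g using Polynomial.induction_on' with
  | add g g' hg hg' => rw [map_add, add_mul, map_add, hg, hg', add_mul]
  | monomial l a =>
    rw [expand_monomial, ← C_mul_X_pow_eq_monomial, mul_assoc, mul_assoc]
    ext m
    rw [coeff_C_mul, coeff_residue hn, coeff_C_mul, coeff_X_pow_mul', coeff_X_pow_mul',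
      coeff_residue hn]
    by_cases hm : n ∣ m
    · obtain ⟨m, rfl⟩ := hm
      by_cases hlm : l ≤ m
      · have h1 : l * n ≤ n * m := by rw [mul_comm]; exact Nat.mul_le_mul_left _ hlm
        rw [if_pos (dvd_mul_right _ _), if_pos (by omega), if_pos h1,
          if_pos (Nat.dvd_sub (dvd_mul_right _ _) (dvd_mul_left _ _)), Nat.sub_add_comm h1]
      · have h1 : n * m + n ≤ l * n := by
          rw [mul_comm l, ← Nat.mul_succ]; exact Nat.mul_le_mul_left _ (by omega)
        rw [if_pos (dvd_mul_right _ _), if_neg (by omega), if_neg (by omega)]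
    · rw [if_neg hm]
      split_ifs with h1 h2
      · exact absurd ((Nat.dvd_sub_iff_left h1 (dvd_mul_left _ _)).1 h2) hm
      · simp
      · simp

theorem sum_X_pow_mul_residue {n : ℕ} (hn : 0 < n) (f : k[X]) :
    ∑ i ∈ Finset.range n, X ^ i * residue n i f = f := by
  ext m
  rw [finsetSum_coeff, Finset.sum_eq_single (m % n)]
  · rw [coeff_X_pow_mul', if_pos (Nat.mod_le _ _), coeff_residue hn, if_pos (Nat.dvd_sub_mod m),
      Nat.sub_add_cancel (Nat.mod_le _ _)]
  · intro i hi him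
    rw [coeff_X_pow_mul', coeff_residue hn]
    split_ifs with h1 h2
    · refine absurd ?_ him
      have := (Nat.modEq_iff_dvd' h1).2 h2
      rw [← this, Nat.mod_eq_of_lt (Finset.mem_range.1 hi)]
    · rfl
    · rfl
  · intro hc
    exact absurd (Finset.mem_range.2 (Nat.mod_lt _ hn)) hc

theorem residue_X_pow_mul {n : ℕ} (hn : 0 < n) (i : ℕ) (f : k[X]) :
    residue n i (X ^ i * f) = residue n 0 f := by
  ext m
  rw [coeff_residue hn, coeff_residue hn, coeff_X_pow_mul, add_zero]

/-- Multiplication by `X ^ i` carries the class of `n - i` to the class of `0`, one full period up.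
This carry is the source of every factor `c` in the discriminant. -/
theorem residue_zero_X_pow_mul {n i : ℕ} (h0 : 0 < i) (hi : i ≤ n) (f : k[X]) :
    residue n 0 (X ^ i * f) = X ^ n * residue n (n - i) f := by
  have hn : 0 < n := by omega
  ext m
  rw [coeff_residue hn, coeff_X_pow_mul', coeff_X_pow_mul', coeff_residue hn, add_zero]
  by_cases hm : n ∣ m
  · obtain ⟨m, rfl⟩ := hm
    rcases m with _ | m
    · rw [if_pos (dvd_mul_right _ _), if_neg (by omega), if_neg (by omega)]
    · have h1 : n * (m + 1) = n * m + n := Nat.mul_succ _ _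
      rw [if_pos (dvd_mul_right _ _), if_pos (by omega), if_pos (by omega), h1,
        Nat.add_sub_cancel, if_pos (dvd_mul_right _ _)]
      congr 1
      omega
  · rw [if_neg hm]
    split_ifs with h1 h2
    · exact absurd ((Nat.dvd_sub_iff_left h1 dvd_rfl).1 h2) hm
    · rfl
    · rfl

theorem residue_X_pow {n i j : ℕ} (hj : j < n) :
    residue n i (X ^ j : k[X]) = if i = j then 1 else 0 := by
  have hn : 0 < n := by omega
  ext m
  rw [coeff_residue hn, coeff_X_pow]
  by_cases hm : m = 0
  · subst hm
    by_cases hij : i = j <;> simp [hij]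
  · have h1 : n ∣ m → m + i ≠ j := fun h => by
      have := Nat.le_of_dvd (Nat.pos_of_ne_zero hm) h
      omega
    have h2 : (if i = j then (1 : k[X]) else 0).coeff m = 0 := by
      split_ifs <;> simp [coeff_one, hm]
    rw [h2]
    split_ifs with h3 h4
    · exact absurd h4 (h1 h3)
    · rfl
    · rfl

end Residue

/-! ### The automorphism and its fixed polynomials -/

/-- `σ` is an automorphism of `k[X]` of order `n` whose fixed ring is `k[X ^ n]`, where `n` is
invertible. -/
structure IsQuantumShift {k : Type*} [Field k] (σ : k[X] ≃ₐ[k] k[X]) (n : ℕ) : Prop where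
  pos : 0 < n
  pow_eq_one : σ ^ n = 1
  dvd_of_fix : ∀ l : ℤ, (σ ^ l) X = X → (n : ℤ) ∣ l
  fix : ∀ f, σ f = f → expand k n (contract n f) = f
  map_expand : ∀ g, σ (expand k n g) = expand k n g
  cast_ne_zero : (n : k) ≠ 0

section Shift

variable {k : Type*} [Field k] {σ : k[X] ≃ₐ[k] k[X]}

theorem shift_pow_apply {q : k} (hσ : σ X = C q * X) (m : ℕ) (f : k[X]) :
    (σ ^ m) f = f.comp (C (q ^ m) * X) := by
  have h1 : ∀ f, σ f = f.comp (C q * X) := by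
    intro f
    have : (σ : k[X] →ₐ[k] k[X]) = aeval (C q * X) := by
      ext
      simp [hσ]
    rw [comp_eq_aeval, ← this]
    rfl
  induction m with
  | zero => simp
  | succ m ih =>
    rw [pow_succ', AlgEquiv.mul_apply, ih, h1, comp_assoc]
    congr 1
    simp [pow_succ, mul_assoc]

/-- The coefficient of `X ^ m` is scaled by `q ^ m`, so `q` is a primitive `n`-th root of unity and
fixed polynomials live in degrees divisible by `n`. A characteristic `p` dividing `n` would make `q
^ (n / p)` a `p`-th root of unity, hence `1`, against primitivity. -/
theorem IsQuantumShift.of_orderOf (q : kˣ) (hσ : σ X = C (q : k) * X) {n : ℕ} (hn : 0 < n)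
    (hord : orderOf σ = n) : IsQuantumShift σ n := by
  have hdvd : ∀ l : ℤ, (σ ^ l) X = X → (n : ℤ) ∣ l := by
    intro l hl
    rw [← hord, orderOf_dvd_iff_zpow_eq_one]
    have : ((σ ^ l : k[X] ≃ₐ[k] k[X]) : k[X] →ₐ[k] k[X]) = AlgHom.id k k[X] := by
      ext
      simpa using congrArg (fun f => coeff f _) hl
    ext1 f
    exact DFunLike.congr_fun this f
  have hpow : σ ^ n = 1 := by rw [← hord, pow_orderOf_eq_one]
  have hq : ∀ m : ℕ, (q : k) ^ m = 1 ↔ n ∣ m := by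
    intro m
    constructor
    · intro hm
      have := hdvd m (by rw [zpow_natCast, shift_pow_apply hσ, hm]; simp)
      exact_mod_cast this
    · rintro ⟨m, rfl⟩
      have h1 : (σ ^ n) X = X := by rw [hpow]; rfl
      rw [shift_pow_apply hσ, X_comp] at h1
      have h2 : (q : k) ^ n = 1 := by
        simpa only [coeff_C_mul, coeff_X_one, mul_one] using congrArg (fun f => coeff f 1) h1
      rw [pow_mul, h2, one_pow]
  have hcoeff : ∀ f m, (σ f).coeff m = f.coeff m * (q : k) ^ m := by
    intro f m
    rw [← pow_one σ, shift_pow_apply hσ, pow_one, comp_C_mul_X_coeff]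
  have hprim : IsPrimitiveRoot (q : k) n := ⟨(hq n).2 dvd_rfl, fun l hl => (hq l).1 hl⟩
  refine ⟨hn, hpow, hdvd, fun f hf => ?_, fun g => ?_, ?_⟩
  · ext m
    rw [coeff_expand hn, coeff_contract hn.ne']
    split_ifs with hm
    · rw [Nat.div_mul_cancel hm]
    · have h1 := hcoeff f m
      rw [hf] at h1
      by_contra h0
      refine hm ((hq m).1 ?_)
      exact mul_left_cancel₀ (Ne.symm h0) (by rw [← h1, mul_one])
  · ext m
    rw [hcoeff, coeff_expand hn]
    split_ifs with hm
    · rw [(hq m).2 hm, mul_one]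
    · rw [zero_mul]
  · have : NeZero n := ⟨hn.ne'⟩
    exact hprim.neZero'.ne

namespace IsQuantumShift

variable {n : ℕ} (Q : IsQuantumShift σ n)

include Q

theorem zpow_eq_one {l : ℤ} (hl : (n : ℤ) ∣ l) : σ ^ l = 1 := by
  obtain ⟨m, rfl⟩ := hl
  rw [zpow_mul, zpow_natCast, Q.pow_eq_one, one_zpow]

theorem zpow_apply {l : ℤ} (hl : (n : ℤ) ∣ l) (f : k[X]) : (σ ^ l) f = f := by
  rw [Q.zpow_eq_one hl]
  rfl

omit Q in
theorem zpow_apply_of_fix (l : ℤ) {f : k[X]} (hf : σ f = f) : (σ ^ l) f = f := by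
  have h1 : σ ∈ MulAction.stabilizer (k[X] ≃ₐ[k] k[X]) f := hf
  exact Subgroup.zpow_mem _ h1 l

theorem residue_mul {i : ℕ} (hi : i < n) {g : k[X]} (hg : σ g = g) (f : k[X]) :
    residue n i (g * f) = g * residue n i f := by
  rw [← Q.fix g hg, residue_expand_mul hi]

theorem map_residue (i : ℕ) (f : k[X]) : σ (residue n i f) = residue n i f := by
  rw [residue_eq_expand Q.pos, Q.map_expand]

end IsQuantumShift

end Shift

/-! ### Projections in the skew Laurent ring -/

namespace SkewLaurent

variable {k : Type*} [Field k] {σ : k[X] ≃ₐ[k] k[X]} {n : ℕ}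

/-- The Laurent polynomials in `X ^ n` with `σ`-fixed coefficients. -/
def IsDiag (n : ℕ) (s : SkewLaurent σ) : Prop :=
  ∀ l, (¬ (n : ℤ) ∣ l → cf σ s l = 0) ∧ σ (cf σ s l) = cf σ s l

/-- The projection onto the coefficients in degrees congruent to `0` modulo `n` in `X`, and
`i` modulo `n` in the base. -/
noncomputable def projS (n i : ℕ) : SkewLaurent σ →+ SkewLaurent σ :=
  ((cf σ).symm : (ℤ →₀ k[X]) →+ SkewLaurent σ).comp
    (((Finsupp.filterAddHom fun l : ℤ => (n : ℤ) ∣ l).comp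
      (Finsupp.mapRange.addMonoidHom (residue n i))).comp (cf σ : SkewLaurent σ →+ (ℤ →₀ k[X])))

theorem cf_projS (i : ℕ) (s : SkewLaurent σ) (l : ℤ) :
    cf σ (projS n i s) l = if (n : ℤ) ∣ l then residue n i (cf σ s l) else 0 := by
  have : cf σ (projS n i s) = (Finsupp.filterAddHom fun l : ℤ => (n : ℤ) ∣ l)
      (Finsupp.mapRange.addMonoidHom (residue n i) (cf σ s)) := (cf σ).apply_symm_apply _
  rw [this]
  change Finsupp.filter _ _ l = _
  rw [Finsupp.filter_apply]
  rfl

section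

variable (Q : IsQuantumShift σ n)

include Q

omit Q in
theorem isDiag_term {l : ℤ} (hl : (n : ℤ) ∣ l) {f : k[X]} (hf : σ f = f) :
    IsDiag n (term σ l f) := by
  intro j
  rw [cf_term]
  split_ifs with hj
  · exact ⟨fun hc => absurd (hj ▸ hl) hc, hf⟩
  · simp

theorem isDiag_projS (i : ℕ) (s : SkewLaurent σ) : IsDiag n (projS n i s) := by
  intro l
  rw [cf_projS]
  split_ifs with hl
  · exact ⟨fun hc => absurd hl hc, Q.map_residue i _⟩
  · simp

/-- In the terms of both products neither twist acts: `σ ^ j` is trivial for `n ∣ j`, and the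
coefficients of `z` are fixed. -/
theorem IsDiag.mul_comm {z : SkewLaurent σ} (hz : IsDiag n z) (s : SkewLaurent σ) :
    z * s = s * z := by
  refine ext_cf fun l => ?_
  rw [cf_mul, cf_mul']
  refine Finsupp.sum_congr fun j hj => ?_
  have hj' : (n : ℤ) ∣ j := by
    by_contra hc
    exact Finsupp.mem_support_iff.1 hj ((hz j).1 hc)
  rw [Q.zpow_apply hj', IsQuantumShift.zpow_apply_of_fix _ (hz j).2, _root_.mul_comm]

theorem projS_mul {i : ℕ} (hi : i < n) {z : SkewLaurent σ} (hz : IsDiag n z)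
    (s : SkewLaurent σ) : projS n i (z * s) = z * projS n i s := by
  refine ext_cf fun l => ?_
  rw [cf_projS, cf_mul, cf_mul, Finsupp.sum, Finsupp.sum, map_sum]
  have hj : ∀ j ∈ (cf σ z).support, (n : ℤ) ∣ j := by
    intro j hj
    by_contra hc
    exact Finsupp.mem_support_iff.1 hj ((hz j).1 hc)
  split_ifs with hl
  · refine Finset.sum_congr rfl fun j hjz => ?_
    rw [cf_projS, if_pos (dvd_sub hl (hj j hjz)), Q.zpow_apply (hj j hjz),
      Q.zpow_apply (hj j hjz), Q.residue_mul hi (hz j).2]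
  · refine (Finset.sum_eq_zero fun j hjz => ?_).symm
    rw [cf_projS, if_neg fun hc => hl ((dvd_sub_left (hj j hjz)).1 hc), map_zero, mul_zero]

theorem projS_term_X_pow_mul (i : ℕ) (s : SkewLaurent σ) :
    projS n i (term σ 0 (X ^ i) * s) = projS n 0 s := by
  refine ext_cf fun l => ?_
  rw [cf_projS, cf_projS, cf_term_mul, sub_zero, zpow_zero, AlgEquiv.one_apply,
    residue_X_pow_mul Q.pos]

/-- Only degrees divisible by `n` survive the projection, and there the base commutes with the
powers of `X`. This is the symmetry behind the trace computation. -/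
theorem projS_mul_term (i : ℕ) (s : SkewLaurent σ) (f : k[X]) :
    projS n i (s * term σ 0 f) = projS n i (term σ 0 f * s) := by
  refine ext_cf fun l => ?_
  rw [cf_projS, cf_projS, cf_term_mul, cf_mul_term, sub_zero, zpow_zero, AlgEquiv.one_apply]
  split_ifs with hl
  · rw [Q.zpow_apply hl, _root_.mul_comm]
  · rfl

omit Q in
theorem projS_zero_term_X_pow_mul {i : ℕ} (h0 : 0 < i) (hi : i ≤ n) (s : SkewLaurent σ) :
    projS n 0 (term σ 0 (X ^ i) * s) = term σ 0 (X ^ n) * projS n (n - i) s := by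
  refine ext_cf fun l => ?_
  rw [cf_projS, cf_term_mul, cf_term_mul, cf_projS, sub_zero, zpow_zero, AlgEquiv.one_apply,
    AlgEquiv.one_apply, residue_zero_X_pow_mul h0 hi]
  split_ifs <;> simp

omit Q in
theorem projS_term (i : ℕ) {m : ℤ} (hm : ¬ (n : ℤ) ∣ m) (f : k[X]) :
    projS n i (term σ m f) = 0 := by
  refine ext_cf fun l => ?_
  rw [cf_projS, cf_term]
  split_ifs with h1 h2
  · exact absurd (h2 ▸ h1) hm
  · simp
  · simp

omit Q in
theorem projS_term_X_pow (i : ℕ) {j : ℕ} (hj : j < n) :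
    projS n i (term σ 0 (X ^ j)) = if i = j then 1 else 0 := by
  refine ext_cf fun l => ?_
  rw [cf_projS, cf_term]
  by_cases hl : 0 = l
  · subst hl
    rw [if_pos (dvd_zero _), if_pos rfl, residue_X_pow hj]
    split_ifs
    · rw [← term_one, cf_term, if_pos rfl]
    · simp
  · rw [if_neg hl, map_zero, ite_self]
    split_ifs
    · rw [← term_one, cf_term, if_neg hl]
    · simp

theorem sum_projS_mul (s : SkewLaurent σ) (l : ℤ) :
    cf σ (∑ i ∈ Finset.range n, projS n i s * term σ 0 (X ^ i)) l =
      if (n : ℤ) ∣ l then cf σ s l else 0 := by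
  rw [map_sum, Finsupp.finsetSum_apply]
  simp only [cf_mul_term, cf_projS, sub_zero]
  split_ifs with hl
  · simp only [Q.zpow_apply hl]
    conv_rhs => rw [← sum_X_pow_mul_residue Q.pos (cf σ s l)]
    exact Finset.sum_congr rfl fun i _ => _root_.mul_comm _ _
  · simp

/-- The expansion of `s g ^ n` along the basis `t ^ i g ^ j`, for `g` homogeneous of degree `±1`. -/
theorem sum_sum_projS {d : ℤ} (hd : d * d = 1) {g : SkewLaurent σ} {r : ℕ → k[X]}
    (hg : ∀ m : ℕ, g ^ m = term σ (d * m) (r m)) (s : SkewLaurent σ) :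
    ∑ j ∈ Finset.range n, ∑ i ∈ Finset.range n,
      projS n i (s * g ^ (n - j)) * (term σ 0 (X ^ i) * g ^ j) = s * g ^ n := by
  simp only [← mul_assoc, ← Finset.sum_mul]
  refine ext_cf fun l => ?_
  rw [map_sum, Finsupp.finsetSum_apply]
  have hn : (n : ℤ) ≠ 0 := by exact_mod_cast Q.pos.ne'
  have h1 : ∀ j ∈ Finset.range n, cf σ ((∑ i ∈ Finset.range n,
      projS n i (s * g ^ (n - j)) * term σ 0 (X ^ i)) * g ^ j) l =
      if j = ((d * l) % n).toNat then cf σ (s * g ^ n) l else 0 := by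
    intro j hj
    have h2 : s * g ^ n = (s * g ^ (n - j)) * g ^ j := by
      rw [mul_assoc, ← pow_add, Nat.sub_add_cancel (Finset.mem_range.1 hj).le]
    rw [h2]
    generalize s * g ^ (n - j) = s'
    rw [hg j, cf_mul_term, cf_mul_term, sum_projS_mul Q]
    -- As `d` is its own inverse, exactly one `j < n` satisfies `d j ≡ l` modulo `n`, so each degree
    -- `l` is reached by one summand of the outer sum.
    have h3 : (n : ℤ) ∣ l - d * j ↔ j = ((d * l) % n).toNat := by
      have h4 : (n : ℤ) ∣ l - d * j ↔ (n : ℤ) ∣ d * l - j := by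
        constructor
        · intro h
          have : d * l - j = d * (l - d * j) := by rw [mul_sub, ← mul_assoc, hd, one_mul]
          rw [this]
          exact Dvd.dvd.mul_left h _
        · intro h
          have : l - d * j = d * (d * l - j) := by rw [mul_sub, ← mul_assoc, hd, one_mul]
          rw [this]
          exact Dvd.dvd.mul_left h _
      have h5 := Int.emod_nonneg (d * l) hn
      have h6 := Finset.mem_range.1 hj
      rw [h4, ← Int.modEq_iff_dvd, Int.ModEq,
        Int.emod_eq_of_lt (by omega) (by omega : (j : ℤ) < n)]
      omega
    by_cases h7 : (n : ℤ) ∣ l - d * j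
    · rw [if_pos h7, if_pos (h3.1 h7)]
    · rw [if_neg h7, if_neg fun hc => h7 (h3.2 hc), zero_mul]
  rw [Finset.sum_congr rfl h1, Finset.sum_ite_eq', if_pos]
  have h5 := Int.emod_nonneg (d * l) hn
  have h6 := Int.emod_lt_of_pos (d * l) (by omega : (0 : ℤ) < n)
  rw [Finset.mem_range]
  omega

end

end SkewLaurent

/-! ### Center, dual families and trace -/

namespace GWA

open SkewLaurent

variable {k : Type*} [Field k] {σ : k[X] ≃ₐ[k] k[X]} {h : k[X]} {n : ℕ}

theorem center_smul_eq (z : Subalgebra.center k (GWA k σ h)) (w : GWA k σ h) : z • w = w * z :=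
  (Algebra.smul_def z w).trans (Algebra.commutes z w)

section Center

variable (Q : IsQuantumShift σ n) (hh : h ≠ 0)

include Q hh

/-- Splitting `weight (n + 1)` as `n + 1` and as `1 + n` and cancelling `weight 1` shows that `σ⁻¹`
fixes `weight n`. -/
theorem map_weight : σ (weight σ h n) = weight σ h n := by
  have h1 : weight σ h (n + 1) = weight σ h n * weight σ h 1 := by
    rw [weight_add, Q.zpow_apply (dvd_neg.2 dvd_rfl)]
  rw [add_comm, weight_add, mul_comm] at h1
  have h2 := mul_right_cancel₀ (weight_ne_zero σ hh 1) h1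
  conv_lhs => rw [← h2]
  change (σ ^ (1 : ℤ)) _ = _
  rw [← AlgEquiv.mul_apply, ← zpow_add]
  simp

theorem weight_mul (m : ℕ) : weight σ h (n * m) = weight σ h n ^ m := by
  induction m with
  | zero => simp [weight_zero]
  | succ m ih =>
    rw [Nat.mul_succ, weight_add, ih, pow_succ,
      IsQuantumShift.zpow_apply_of_fix _ (map_weight Q hh)]

theorem map_weight_of_dvd {l : ℤ} (hl : (n : ℤ) ∣ l) :
    σ (weight σ h (-l).toNat) = weight σ h (-l).toNat := by
  obtain ⟨m, hm⟩ : n ∣ (-l).toNat := by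
    rcases Int.le_total 0 l with h0 | h0
    · rw [Int.toNat_of_nonpos (by omega)]
      exact dvd_zero _
    · rw [← Int.natCast_dvd_natCast, Int.toNat_of_nonneg (by omega)]
      exact dvd_neg.2 hl
  rw [hm, weight_mul Q hh, map_pow, map_weight Q hh]

/-- Commuting with `t` forces degrees divisible by `n`, and commuting with `x` forces fixed
coefficients. Conversely such elements are central in the whole Laurent ring. -/
theorem mem_center_iff (w : GWA k σ h) :
    w ∈ Subalgebra.center k (GWA k σ h) ↔ IsDiag n (emb σ h w) := by
  rw [Subalgebra.mem_center_iff]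
  constructor
  · intro H l
    have hX := congrArg (fun w => cf σ (emb σ h w) l) (H (ofBase σ h X))
    have hx := congrArg (fun w => cf σ (emb σ h w) (l + 1)) (H (x σ h))
    simp only [map_mul, emb_ofBase, emb_x, cf_term_mul, cf_mul_term, sub_zero, zpow_zero,
      AlgEquiv.one_apply, add_sub_cancel_right, map_one, one_mul, mul_one, zpow_one] at hX hx
    refine ⟨fun hl => ?_, hx⟩
    by_contra hc
    refine hl (Q.dvd_of_fix l (mul_left_cancel₀ hc ?_))
    rw [← hX, mul_comm]
  · intro H w'
    apply emb_injective σ hh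
    rw [map_mul, map_mul, H.mul_comm Q]

/-- The weights in degrees divisible by `n` are fixed, so they factor out of `residue` and
divisibility persists. -/
theorem projS_mem_range {i : ℕ} (hi : i < n) (w : GWA k σ h) :
    projS n i (emb σ h w) ∈ Set.range (emb σ h) := by
  rw [mem_range_emb_iff]
  intro l
  rw [cf_projS]
  split_ifs with hl
  · obtain ⟨g, hg⟩ := (mem_range_emb_iff σ h _).1 ⟨w, rfl⟩ l
    rw [hg, Q.residue_mul hi (map_weight_of_dvd Q hh hl)]
    exact dvd_mul_right _ _
  · exact dvd_zero _

theorem exists_proj {i : ℕ} (hi : i < n) :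
    ∃ f : GWA k σ h →ₗ[Subalgebra.center k (GWA k σ h)] Subalgebra.center k (GWA k σ h),
      ∀ w, emb σ h (f w) = projS n i (emb σ h w) := by
  have key : ∀ w, ∃ z : Subalgebra.center k (GWA k σ h),
      emb σ h z = projS n i (emb σ h w) := by
    intro w
    obtain ⟨z, hz⟩ := projS_mem_range Q hh hi w
    exact ⟨⟨z, (mem_center_iff Q hh z).2 (hz ▸ isDiag_projS Q _ _)⟩, hz⟩
  choose f hf using key
  refine ⟨{ toFun := f, map_add' := fun w w' => ?_, map_smul' := fun z w => ?_ }, hf⟩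
  · apply Subtype.val_injective
    apply emb_injective σ hh
    rw [hf, map_add, map_add, AddMemClass.coe_add, map_add, hf, hf]
  · apply Subtype.val_injective
    apply emb_injective σ hh
    rw [hf, RingHom.id_apply, smul_eq_mul, MulMemClass.coe_mul, map_mul, hf, Algebra.smul_def,
      map_mul]
    exact projS_mul Q hi ((mem_center_iff Q hh _).1 z.2) _

end Center

/-- The coordinate functionals with values in the center. -/
noncomputable def proj (Q : IsQuantumShift σ n) (hh : h ≠ 0) (i : Fin n) :
    GWA k σ h →ₗ[Subalgebra.center k (GWA k σ h)] Subalgebra.center k (GWA k σ h) :=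
  (exists_proj Q hh i.2).choose

section Proj

variable (Q : IsQuantumShift σ n) (hh : h ≠ 0)

theorem emb_proj (i : Fin n) (w : GWA k σ h) :
    emb σ h (proj Q hh i w) = projS n i (emb σ h w) :=
  (exists_proj Q hh i.2).choose_spec w

theorem center_ext {z z' : Subalgebra.center k (GWA k σ h)} (hh : h ≠ 0)
    (H : emb σ h z = emb σ h z') : z = z' :=
  Subtype.val_injective (emb_injective σ hh H)

theorem proj_X_pow_mul (i : Fin n) (w : GWA k σ h) :
    proj Q hh i (ofBase σ h X ^ (i : ℕ) * w) = proj Q hh ⟨0, Q.pos⟩ w := by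
  apply center_ext hh
  rw [emb_proj, emb_proj, map_mul, ← map_pow, emb_ofBase, projS_term_X_pow_mul Q]

theorem proj_mul_X_pow (i : Fin n) (m : ℕ) (w : GWA k σ h) :
    proj Q hh i (w * ofBase σ h X ^ m) = proj Q hh i (ofBase σ h X ^ m * w) := by
  apply center_ext hh
  rw [emb_proj, emb_proj, map_mul (emb σ h), map_mul (emb σ h), ← map_pow, emb_ofBase,
    projS_mul_term Q]

theorem proj_zero_X_pow_mul {c : Subalgebra.center k (GWA k σ h)}
    (hc : (c : GWA k σ h) = ofBase σ h X ^ n) {i : ℕ} (h0 : 0 < i) (j : Fin n) (hij : i + j = n)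
    (w : GWA k σ h) :
    proj Q hh ⟨0, Q.pos⟩ (ofBase σ h X ^ i * w) = c * proj Q hh j w := by
  apply center_ext hh
  rw [MulMemClass.coe_mul, map_mul (emb σ h), emb_proj, emb_proj, map_mul (emb σ h), hc, ← map_pow, ← map_pow,
    emb_ofBase, emb_ofBase, projS_zero_term_X_pow_mul h0 (by omega)]
  congr 3
  omega

theorem proj_X_pow (i j : Fin n) :
    proj Q hh i (ofBase σ h X ^ (j : ℕ)) = if i = j then 1 else 0 := by
  apply center_ext hh
  rw [emb_proj, ← map_pow, emb_ofBase, projS_term_X_pow _ j.2]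
  by_cases hij : i = j
  · subst hij; simp
  · rw [if_neg hij, if_neg fun hc => hij (Fin.ext hc)]; simp

end Proj

/-- `g` is homogeneous of degree `d = ±1`, with central `n`-th power `s`. -/
structure IsHomogeneousUnit (n : ℕ) (g : GWA k σ h) (d : ℤ) (s : Subalgebra.center k (GWA k σ h)) :
    Prop where
  mul_self : d * d = 1
  exists_emb_pow : ∃ r : ℕ → k[X], ∀ m : ℕ, emb σ h (g ^ m) = term σ (d * m) (r m)
  coe_eq : (s : GWA k σ h) = g ^ n

namespace IsHomogeneousUnit

variable (Q : IsQuantumShift σ n) (hh : h ≠ 0) {g : GWA k σ h} {d : ℤ}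
  {s : Subalgebra.center k (GWA k σ h)} (G : IsHomogeneousUnit n g d s)

include G

theorem proj_mul_pow_eq_zero (i : Fin n) (m l : ℕ) (hl : ¬ n ∣ l) :
    proj Q hh i (ofBase σ h X ^ m * g ^ l) = 0 := by
  apply center_ext hh
  obtain ⟨r, hr⟩ := G.exists_emb_pow
  rw [emb_proj, map_mul, ← map_pow, emb_ofBase, hr, term_mul_term, projS_term]
  · simp
  · intro hc
    apply hl
    have h1 := Dvd.dvd.mul_left hc d
    rwa [zero_add, ← mul_assoc, G.mul_self, one_mul, Int.natCast_dvd_natCast] at h1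

omit G in
theorem not_dvd_add_sub {j j' : Fin n} (hj : j ≠ j') : ¬ n ∣ (j : ℕ) + (n - (j' : ℕ)) := by
  rintro ⟨m, hm⟩
  have h1 := j.2
  have h2 := j'.2
  have h3 : (j : ℕ) ≠ j' := fun hc => hj (Fin.ext hc)
  -- The number `j + (n - j')` lies strictly between `0` and `2 * n`, so it could only be `n`, which
  -- forces `j = j'`.
  rcases m with _ | _ | m
  · omega
  · omega
  · have : n * 2 ≤ n * (m + 1 + 1) := Nat.mul_le_mul_left _ (by omega)
    omega

theorem pow_mul_pow_sub (j : Fin n) : g ^ (j : ℕ) * g ^ (n - (j : ℕ)) = s := by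
  rw [← pow_add, Nat.add_sub_cancel' j.2.le, G.coe_eq]

/-- The elements `t ^ i g ^ j` and their coordinate functionals. -/
noncomputable def dualFamily : DualFamily (GWA k σ h) s (Fin n × Fin n) where
  e p := ofBase σ h X ^ (p.1 : ℕ) * g ^ (p.2 : ℕ)
  -- Right multiplication by `g ^ (n - j)` turns the `g ^ j` part into a multiple of `g ^ n = s` and
  -- moves the other parts to degrees not divisible by `n`, which `proj` kills.
  coord p := proj Q hh p.1 ∘ₗ
    LinearMap.mulRight (Subalgebra.center k (GWA k σ h)) (g ^ (n - (p.2 : ℕ)))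
  sum_coord w := by
    apply emb_injective σ hh
    obtain ⟨r, hr⟩ := G.exists_emb_pow
    have h1 := sum_sum_projS Q G.mul_self (g := emb σ h g) (fun m => by rw [← map_pow, hr])
      (emb σ h w)
    rw [center_smul_eq]
    refine Eq.trans ?_ (h1.trans ?_)
    · rw [map_sum, Fintype.sum_prod_type_right]
      simp only [← Fin.sum_univ_eq_sum_range, Algebra.smul_def, map_mul, LinearMap.comp_apply,
        LinearMap.mulRight_apply, map_pow]
      refine Finset.sum_congr rfl fun j _ => Finset.sum_congr rfl fun i _ => ?_
      have h2 : emb σ h (ofBase σ h X) ^ (i : ℕ) = term σ 0 (X ^ (i : ℕ)) := by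
        rw [← map_pow, ← map_pow, emb_ofBase]
      rw [h2]
      congr 1
      refine (emb_proj Q hh i _).trans ?_
      rw [map_mul, map_pow]
    · rw [← map_pow, ← G.coe_eq, ← map_mul]
  coord_e p p' := by
    rw [LinearMap.comp_apply, LinearMap.mulRight_apply, mul_assoc]
    by_cases hj : p'.2 = p.2
    · rw [hj, G.pow_mul_pow_sub]
      have : ofBase σ h X ^ (p'.1 : ℕ) * (s : GWA k σ h) = s • ofBase σ h X ^ (p'.1 : ℕ) :=
        (center_smul_eq _ _).symm
      rw [this, map_smul, proj_X_pow, smul_eq_mul]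
      by_cases hi : p.1 = p'.1 <;> simp [Prod.ext_iff, hi, hj.symm]
    · rw [← pow_add, G.proj_mul_pow_eq_zero Q hh _ _ _ (not_dvd_add_sub hj), if_neg]
      rintro rfl
      exact hj rfl

end IsHomogeneousUnit

/-- `n ^ 2` times the projection to the center; it turns out to be the regular trace. -/
noncomputable def traceMap (Q : IsQuantumShift σ n) (hh : h ≠ 0) :
    GWA k σ h →ₗ[Subalgebra.center k (GWA k σ h)] Subalgebra.center k (GWA k σ h) :=
  n ^ 2 • proj Q hh ⟨0, Q.pos⟩

namespace IsHomogeneousUnit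

variable (Q : IsQuantumShift σ n) (hh : h ≠ 0) {g : GWA k σ h} {d : ℤ}
  {s : Subalgebra.center k (GWA k σ h)} (G : IsHomogeneousUnit n g d s)
  {c : Subalgebra.center k (GWA k σ h)} (hc : (c : GWA k σ h) = ofBase σ h X ^ n)

include G in
-- All `n ^ 2` diagonal entries agree: since `g ^ j * g ^ (n - j) = s`, the entry at `(i, j)` is `s`
-- times the `i`-th projection of `w tⁱ`, which is that of `tⁱ w`, namely the `0`-th projection of
-- `w`.
theorem regularTrace_eq [IsDomain (Subalgebra.center k (GWA k σ h))] (hs : s ≠ 0)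
    (w : GWA k σ h) : regularTrace (Subalgebra.center k (GWA k σ h)) w =
      algebraMap _ (FractionRing (Subalgebra.center k (GWA k σ h))) (traceMap Q hh w) := by
  refine (G.dualFamily Q hh).regularTrace_eq hs ?_
  have h1 : ∀ p : Fin n × Fin n, (G.dualFamily Q hh).coord p (w * (G.dualFamily Q hh).e p) =
      s * proj Q hh ⟨0, Q.pos⟩ w := by
    intro p
    change proj Q hh p.1 (w * (ofBase σ h X ^ (p.1 : ℕ) * g ^ (p.2 : ℕ)) *
      g ^ (n - (p.2 : ℕ))) = _
    have h2 : w * (ofBase σ h X ^ (p.1 : ℕ) * g ^ (p.2 : ℕ)) * g ^ (n - (p.2 : ℕ)) =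
        s • (w * ofBase σ h X ^ (p.1 : ℕ)) := by
      rw [Algebra.smul_def, Algebra.commutes, ← mul_assoc, mul_assoc _ (g ^ (p.2 : ℕ)),
        G.pow_mul_pow_sub]
      rfl
    rw [h2, map_smul, proj_mul_X_pow, proj_X_pow_mul, smul_eq_mul]
  simp only [h1, Finset.sum_const, Finset.card_univ, Fintype.card_prod, Fintype.card_fin, traceMap,
    LinearMap.smul_apply, nsmul_eq_mul]
  push_cast
  ring

include hc in
theorem dvd_traceMap (p : Fin n × Fin n) (w : GWA k σ h) :
    (if (p.1 : ℕ) = 0 then 1 else c) ∣ traceMap Q hh ((G.dualFamily Q hh).e p * w) := by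
  split_ifs with hp
  · exact one_dvd _
  · change c ∣ n ^ 2 • proj Q hh ⟨0, Q.pos⟩ (ofBase σ h X ^ (p.1 : ℕ) * g ^ (p.2 : ℕ) * w)
    have h1 := p.1.2
    rw [mul_assoc, proj_zero_X_pow_mul Q hh hc (Nat.pos_of_ne_zero hp)
      ⟨n - p.1, by omega⟩ (by dsimp; omega), nsmul_eq_mul]
    exact Dvd.dvd.mul_left (dvd_mul_right _ _) _

include hc in
/-- The discriminant of the family `t ^ i g ^ j` and a family dual to it. -/
theorem exists_det_eq : ∃ u' : Fin n × Fin n → GWA k σ h,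
    (Matrix.of fun p p' => traceMap Q hh ((G.dualFamily Q hh).e p * u' p')).det =
      (n ^ 2 * s) ^ (n * n) * ∏ p : Fin n × Fin n, if (p.1 : ℕ) = 0 then 1 else c := by
  -- The partner of `tⁱ gʲ` is `gⁿ⁻ʲ tⁿ⁻ⁱ`. For `i = 0` the exponent of `t` is `0` instead of `n`,
  -- which avoids a superfluous factor `c`.
  refine ⟨fun p => g ^ (n - (p.2 : ℕ)) * ofBase σ h X ^ (if (p.1 : ℕ) = 0 then 0 else n - p.1), ?_⟩
  have h1 : (Matrix.of fun p p' : Fin n × Fin n => traceMap Q hh ((G.dualFamily Q hh).e p *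
      (g ^ (n - (p'.2 : ℕ)) * ofBase σ h X ^ (if (p'.1 : ℕ) = 0 then 0 else n - p'.1 : ℕ)))) =
      Matrix.diagonal fun p => (n ^ 2 * s) * if (p.1 : ℕ) = 0 then 1 else c := by
    ext1 p p'
    rw [Matrix.of_apply, Matrix.diagonal_apply]
    change n ^ 2 • proj Q hh ⟨0, Q.pos⟩ (ofBase σ h X ^ (p.1 : ℕ) * g ^ (p.2 : ℕ) * _) = _
    rw [← mul_assoc, proj_mul_X_pow, mul_assoc]
    by_cases hj : p.2 = p'.2
    · rw [← hj, G.pow_mul_pow_sub]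
      rw [← center_smul_eq, mul_smul_comm, map_smul]
      have h3 : proj Q hh ⟨0, Q.pos⟩ (ofBase σ h X ^ (if (p'.1 : ℕ) = 0 then 0 else n - p'.1 : ℕ) *
          ofBase σ h X ^ (p.1 : ℕ)) = if p = p' then (if (p.1 : ℕ) = 0 then 1 else c) else 0 := by
        by_cases hp : (p'.1 : ℕ) = 0
        · rw [if_pos hp, pow_zero, one_mul, proj_X_pow]
          by_cases hi : p = p'
          · subst hi
            rw [if_pos rfl, if_pos hp, if_pos (Fin.ext hp.symm)]
          · rw [if_neg hi, if_neg fun hc => hi (Prod.ext (Fin.ext ?_) hj)]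
            rw [← hc, hp]
        · have h4 := p'.1.2
          rw [if_neg hp, proj_zero_X_pow_mul Q hh hc (by omega) p'.1 (by omega), proj_X_pow]
          by_cases hi : p = p'
          · subst hi
            rw [if_pos rfl, if_neg hp, if_pos rfl, mul_one]
          · rw [if_neg hi, if_neg fun hc => hi (Prod.ext hc.symm hj), mul_zero]
      rw [h3, nsmul_eq_mul, smul_eq_mul]
      split_ifs <;> push_cast <;> ring
    · rw [if_neg fun hc => hj (congrArg Prod.snd hc), ← pow_add, ← mul_assoc, ← pow_add,
        G.proj_mul_pow_eq_zero Q hh _ _ _ (not_dvd_add_sub hj), smul_zero]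
  rw [h1, Matrix.det_diagonal, Finset.prod_mul_distrib, Finset.prod_const]
  simp

end IsHomogeneousUnit

end GWA

/-! ### Regularity of `a, b`, finiteness, and the discriminants -/

namespace GWA

open SkewLaurent

variable {k : Type*} [Field k] {σ : k[X] ≃ₐ[k] k[X]} {h : k[X]} {n : ℕ}

section Generators

variable (Q : IsQuantumShift σ n) (hh : h ≠ 0)

include Q hh

theorem x_pow_mem_center : x σ h ^ n ∈ Subalgebra.center k (GWA k σ h) := by
  rw [mem_center_iff Q hh, emb_x_pow]
  exact isDiag_term dvd_rfl (map_one σ)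

theorem y_pow_mem_center : y σ h ^ n ∈ Subalgebra.center k (GWA k σ h) := by
  rw [mem_center_iff Q hh, emb_y_pow]
  exact isDiag_term (dvd_neg.2 dvd_rfl) (map_weight Q hh)

theorem ofBase_mem_center {f : k[X]} (hf : σ f = f) :
    ofBase σ h f ∈ Subalgebra.center k (GWA k σ h) := by
  rw [mem_center_iff Q hh, emb_ofBase]
  exact isDiag_term (dvd_zero _) hf

theorem t_pow_mem_center : ofBase σ h X ^ n ∈ Subalgebra.center k (GWA k σ h) := by
  rw [← map_pow]
  refine ofBase_mem_center Q hh ?_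
  rw [← expand_X (R := k) n]
  exact Q.map_expand X

end Generators

theorem isHomogeneousUnit_x {a : Subalgebra.center k (GWA k σ h)}
    (ha : (a : GWA k σ h) = x σ h ^ n) : IsHomogeneousUnit n (x σ h) 1 a :=
  ⟨by norm_num, ⟨fun _ => 1, fun m => by rw [emb_x_pow, one_mul]⟩, ha⟩

theorem isHomogeneousUnit_y {b : Subalgebra.center k (GWA k σ h)}
    (hb : (b : GWA k σ h) = y σ h ^ n) : IsHomogeneousUnit n (y σ h) (-1) b :=
  ⟨by norm_num, ⟨weight σ h, fun m => by rw [emb_y_pow, neg_one_mul]⟩, hb⟩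

section Structure

variable (Q : IsQuantumShift σ n) (hh : h ≠ 0)

include hh in
theorem isDomain_center : IsDomain (Subalgebra.center k (GWA k σ h)) := by
  have := GWA.isDomain σ hh
  exact Function.Injective.isDomain (Subalgebra.center k (GWA k σ h)).val.toRingHom
    Subtype.val_injective

include hh in
theorem isTorsionFree_center :
    Module.IsTorsionFree (Subalgebra.center k (GWA k σ h)) (GWA k σ h) := by
  have := GWA.isDomain σ hh
  have := isDomain_center (σ := σ) hh
  refine Module.IsTorsionFree.mk fun z hz w w' hw => ?_
  have hz0 : (z : GWA k σ h) ≠ 0 := fun hc => hz.ne_zero (Subtype.val_injective hc)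
  exact mul_left_cancel₀ hz0 hw

theorem ne_zero_of_emb_eq_term {z : Subalgebra.center k (GWA k σ h)} {l : ℤ} {f : k[X]}
    (hf : f ≠ 0) (hz : emb σ h z = term σ l f) : z ≠ 0 := by
  rintro rfl
  have := congrArg (fun s => cf σ s l) hz
  simp [cf_term, hf.symm] at this

variable {a b c : Subalgebra.center k (GWA k σ h)}
  (ha : (a : GWA k σ h) = x σ h ^ n) (hb : (b : GWA k σ h) = y σ h ^ n)
  (hc : (c : GWA k σ h) = ofBase σ h X ^ n)

include ha in
theorem x_pow_ne_zero : a ≠ 0 :=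
  ne_zero_of_emb_eq_term one_ne_zero (by rw [ha, emb_x_pow])

include hc in
theorem t_pow_ne_zero : c ≠ 0 :=
  ne_zero_of_emb_eq_term (pow_ne_zero n X_ne_zero) (by rw [hc, ← map_pow, emb_ofBase])

include Q hh ha hb

/-- The candidate is `X⁻ⁿ v` in the Laurent ring. In degree `l ≤ 0` its coefficient times `weight n`
is a coefficient of `u` in degree `l - n`, hence divisible by `weight (-l) * weight n`; cancelling
`weight n` puts the candidate in `W`. -/
theorem isRegularPair : IsRegularPair (GWA k σ h) a b := by
  intro u v huv
  have hmul : ∀ (z : Subalgebra.center k (GWA k σ h)) (w : GWA k σ h),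
      emb σ h (z • w) = emb σ h z * emb σ h w := fun z w => map_mul (emb σ h) _ _
  have hn : (n : ℤ) ∣ -n := dvd_neg.2 dvd_rfl
  have h1 : ∀ l, cf σ (emb σ h u) l = weight σ h n * cf σ (emb σ h v) (l + n + n) := by
    intro l
    have := congrArg (fun w => cf σ (emb σ h w) (l + n)) huv
    simp only [hmul, ha, hb, emb_x_pow, emb_y_pow, cf_term_mul, Q.zpow_apply dvd_rfl,
      Q.zpow_apply hn, add_sub_cancel_right, one_mul, sub_neg_eq_add] at this
    exact this
  have h2 : ∀ l, cf σ (term σ (-n) 1 * emb σ h v) l = cf σ (emb σ h v) (l + n) := by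
    intro l
    rw [cf_term_mul, Q.zpow_apply hn, one_mul, sub_neg_eq_add]
  obtain ⟨w, hw⟩ := (mem_range_emb_iff σ h (term σ (-n) 1 * emb σ h v)).2 (by
    intro l
    rcases Int.le_total 0 l with hl | hl
    · rw [Int.toNat_of_nonpos (by omega), weight_zero]
      exact one_dvd _
    · have h3 := (mem_range_emb_iff σ h (emb σ h u)).1 ⟨u, rfl⟩ (l - n)
      rw [h1, sub_add_cancel, ← h2, (by omega : (-(l - n)).toNat = (-l).toNat + n), weight_add,
        IsQuantumShift.zpow_apply_of_fix _ (map_weight Q hh), mul_comm] at h3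
      exact (mul_dvd_mul_iff_left (weight_ne_zero σ hh n)).1 h3)
  refine ⟨w, emb_injective σ hh (ext_cf fun l => ?_), emb_injective σ hh (ext_cf fun l => ?_)⟩
  · rw [hmul, hw, hb, emb_y_pow, cf_term_mul, h2, Q.zpow_apply hn, h1, sub_neg_eq_add]
  · rw [hmul, hw, ha, emb_x_pow, cf_term_mul, h2, Q.zpow_apply dvd_rfl, one_mul, sub_add_cancel]

/-- The common factor found in `W` is central: its product with the nonzero central `a` is central,
and `W` is a domain. -/
theorem isRegularPair_center : IsRegularPair (Subalgebra.center k (GWA k σ h)) a b := by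
  intro u v huv
  have := GWA.isDomain σ hh
  obtain ⟨w, hu, hv⟩ := isRegularPair Q hh ha hb (u : GWA k σ h) v
    (congrArg Subtype.val huv)
  have ha0 : (a : GWA k σ h) ≠ 0 :=
    fun hc => x_pow_ne_zero ha (Subtype.val_injective hc)
  have hw : w ∈ Subalgebra.center k (GWA k σ h) := by
    rw [Subalgebra.mem_center_iff]
    intro w'
    apply mul_left_cancel₀ ha0
    have hv' : (v : GWA k σ h) = a * w := hv
    rw [← mul_assoc, ← mul_assoc, ← hv', ← Subalgebra.mem_center_iff.1 a.2 w', mul_assoc, ← hv']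
    exact Subalgebra.mem_center_iff.1 v.2 w'
  exact ⟨⟨w, hw⟩, Subtype.val_injective hu, Subtype.val_injective hv⟩

omit ha hb in
theorem ofBase_mul_pow_mem_span {g : GWA k σ h} {d : ℤ} {s : Subalgebra.center k (GWA k σ h)}
    (G : IsHomogeneousUnit n g d s) (f : k[X]) (m : ℕ) :
    ofBase σ h f * g ^ m ∈ Submodule.span (Subalgebra.center k (GWA k σ h))
      (Set.range (G.dualFamily Q hh).e) := by
  rw [← sum_X_pow_mul_residue Q.pos f, map_sum, Finset.sum_mul]
  refine Submodule.sum_mem _ fun i hi => ?_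
  let z : Subalgebra.center k (GWA k σ h) :=
    ⟨ofBase σ h (residue n i f), ofBase_mem_center Q hh (Q.map_residue i f)⟩
  have h1 : ofBase σ h (X ^ i * residue n i f) * g ^ m =
      (z * s ^ (m / n)) • (ofBase σ h X ^ i * g ^ (m % n)) := by
    conv_lhs => rw [← Nat.mod_add_div m n]
    rw [mul_smul, center_smul_eq, center_smul_eq, SubmonoidClass.coe_pow, G.coe_eq, ← pow_mul,
      mul_assoc (ofBase σ h X ^ i), ← pow_add, mul_assoc (ofBase σ h X ^ i),
      map_mul, map_pow, mul_assoc]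
    exact congrArg _ (Subalgebra.mem_center_iff.1 z.2 _).symm
  rw [h1]
  exact Submodule.smul_mem _ _ (Submodule.subset_span
    ⟨(⟨i, Finset.mem_range.1 hi⟩, ⟨m % n, Nat.mod_lt _ Q.pos⟩), rfl⟩)

/-- The family for `x` generates the part of degree `≥ 0`, the one for `y` the part of degree `≤ 0`.
-/
theorem finite_center : Module.Finite (Subalgebra.center k (GWA k σ h)) (GWA k σ h) := by
  let S := Submodule.span (Subalgebra.center k (GWA k σ h))
    (Set.range ((isHomogeneousUnit_x ha).dualFamily Q hh).e)
  let S' := Submodule.span (Subalgebra.center k (GWA k σ h))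
    (Set.range ((isHomogeneousUnit_y hb).dualFamily Q hh).e)
  have h1 : S ⊔ S' = ⊤ := by
    refine eq_top_iff.2 fun w _ => ?_
    obtain ⟨g, rfl⟩ := combination_surjective σ h w
    induction g using Finsupp.induction_linear with
    | zero => rw [map_zero]; exact Submodule.zero_mem _
    | add g g' hg hg' =>
      rw [map_add]
      exact Submodule.add_mem _ (hg trivial) (hg' trivial)
    | single i f =>
      rw [combination_single, v]
      split_ifs
      · exact Submodule.mem_sup_left (ofBase_mul_pow_mem_span Q hh _ f _)
      · exact Submodule.mem_sup_right (ofBase_mul_pow_mem_span Q hh _ f _)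
  rw [Module.finite_def, ← h1]
  exact (Submodule.fg_span (Set.finite_range _)).sup (Submodule.fg_span (Set.finite_range _))

theorem discriminantHypothesis :
    DiscriminantHypothesis (Subalgebra.center k (GWA k σ h)) (GWA k σ h) := by
  have h1 := GWA.isDomain σ hh
  have h2 := isDomain_center (σ := σ) hh
  exact
    { isDomain := h2
      injective := Subtype.val_injective
      nontrivial := inferInstance
      prime := fun u v huv => mul_eq_zero.1 (by simpa using huv 1)
      finite := finite_center Q hh ha hb
      trace_mem := fun w => ⟨_, ((isHomogeneousUnit_x ha).regularTrace_eq Q hh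
        (x_pow_ne_zero ha) w).symm⟩ }

theorem isReflexive_center :
    Module.IsReflexive (Subalgebra.center k (GWA k σ h)) (GWA k σ h) := by
  have := isDomain_center (σ := σ) hh
  have := isTorsionFree_center (σ := σ) hh
  exact ((isHomogeneousUnit_x ha).dualFamily Q hh).isReflexive
    ((isHomogeneousUnit_y hb).dualFamily Q hh) (x_pow_ne_zero ha) (isRegularPair Q hh ha hb)

omit hh ha hb in
-- The exponent counts the pairs `(i, j)` with `i ≠ 0`.
theorem prod_ite_eq_pow {A : Type*} [CommMonoid A] (c : A) :
    (∏ p : Fin n × Fin n, if (p.1 : ℕ) = 0 then 1 else c) = c ^ (n * (n - 1)) := by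
  obtain ⟨m, rfl⟩ := Nat.exists_eq_succ_of_ne_zero Q.pos.ne'
  rw [Fintype.prod_prod_type]
  rw [Fin.prod_univ_succ]
  simp [← pow_mul, mul_comm]

include hc

theorem MD_le : MD (Subalgebra.center k (GWA k σ h)) (GWA k σ h) ≤
    Ideal.span {c ^ (n * (n - 1))} := by
  have := isDomain_center (σ := σ) hh
  have hc0 := t_pow_ne_zero hc
  rw [← prod_ite_eq_pow Q c]
  exact MD_le_span ((isHomogeneousUnit_x ha).regularTrace_eq Q hh (x_pow_ne_zero ha))
    ((isHomogeneousUnit_x ha).dualFamily Q hh) ((isHomogeneousUnit_y hb).dualFamily Q hh)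
    (x_pow_ne_zero ha) (isRegularPair_center Q hh ha hb)
    (fun p => by split_ifs; exacts [one_ne_zero, hc0])
    ((isHomogeneousUnit_x ha).dvd_traceMap Q hh hc) ((isHomogeneousUnit_y hb).dvd_traceMap Q hh hc)

omit hb in
theorem pow_mul_pow_mem_MD {g : GWA k σ h} {d : ℤ} {s : Subalgebra.center k (GWA k σ h)}
    (G : IsHomogeneousUnit n g d s) : s ^ (n * n) * c ^ (n * (n - 1)) ∈
      MD (Subalgebra.center k (GWA k σ h)) (GWA k σ h) := by
  have := isDomain_center (σ := σ) hh
  obtain ⟨u', hu'⟩ := G.exists_det_eq Q hh hc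
  have ha0 := x_pow_ne_zero ha
  -- The trace and the rank do not depend on the family, so their values from the `x`-family also
  -- serve for the determinant of the family of `g`.
  have h1 := det_mem_MD ((isHomogeneousUnit_x ha).regularTrace_eq Q hh ha0)
    (((isHomogeneousUnit_x ha).dualFamily Q hh).genericRank_eq ha0) (G.dualFamily Q hh).e u'
  rw [hu', prod_ite_eq_pow Q, mul_pow, mul_assoc] at h1
  -- The factor `(n ^ 2) ^ (n * n)` is a unit because `n ≠ 0` in `k`.
  refine (Ideal.unit_mul_mem_iff_mem _ ?_).1 h1
  have h2 : IsUnit (algebraMap k (Subalgebra.center k (GWA k σ h)) n) :=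
    (IsUnit.mk0 _ Q.cast_ne_zero).map _
  rw [map_natCast] at h2
  exact (h2.pow 2).pow _

theorem mem_reflexiveDiscriminantIdeal_iff (d : Subalgebra.center k (GWA k σ h)) :
    d ∈ reflexiveDiscriminantIdeal (Subalgebra.center k (GWA k σ h)) (GWA k σ h) ↔
      ∃ z, d = c ^ (n * (n - 1)) * z := by
  have := isDomain_center (σ := σ) hh
  have hmem : ∀ {g : GWA k σ h} {d : ℤ} {s : Subalgebra.center k (GWA k σ h)}
      (_ : IsHomogeneousUnit n g d s) (z : Subalgebra.center k (GWA k σ h)),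
      s ^ (n * n) • c ^ (n * (n - 1)) • z ∈
        MD (Subalgebra.center k (GWA k σ h)) (GWA k σ h) := by
    intro g d s G z
    rw [smul_smul, smul_eq_mul, mul_comm]
    exact Ideal.mul_mem_left _ _ (pow_mul_pow_mem_MD Q hh ha hc G)
  exact mem_reflexiveHull_iff (pow_ne_zero (n * n) (x_pow_ne_zero ha))
    (pow_ne_zero _ (t_pow_ne_zero hc)) ((isRegularPair_center Q hh ha hb).pow _ (n * n))
    (fun m hm => Ideal.mem_span_singleton.1 (MD_le Q hh ha hb hc hm))
    (hmem (isHomogeneousUnit_x ha)) (hmem (isHomogeneousUnit_y hb)) d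

theorem mem_extendedReflexiveDiscriminantIdeal_iff (d : GWA k σ h) :
    d ∈ extendedReflexiveDiscriminantIdeal (Subalgebra.center k (GWA k σ h)) (GWA k σ h) ↔
      ∃ w, d = c ^ (n * (n - 1)) • w := by
  have := isDomain_center (σ := σ) hh
  have := isReflexive_center Q hh ha hb
  have hmem : ∀ {g : GWA k σ h} {d : ℤ} {s : Subalgebra.center k (GWA k σ h)}
      (_ : IsHomogeneousUnit n g d s) (w : GWA k σ h), s ^ (n * n) • c ^ (n * (n - 1)) • w ∈
        MD (Subalgebra.center k (GWA k σ h)) (GWA k σ h) •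
          (⊤ : Submodule (Subalgebra.center k (GWA k σ h)) (GWA k σ h)) := by
    intro g d s G w
    rw [smul_smul]
    exact Submodule.smul_mem_smul (pow_mul_pow_mem_MD Q hh ha hc G) trivial
  have hle : ∀ m ∈ MD (Subalgebra.center k (GWA k σ h)) (GWA k σ h) •
      (⊤ : Submodule (Subalgebra.center k (GWA k σ h)) (GWA k σ h)),
      ∃ w, m = c ^ (n * (n - 1)) • w := by
    intro m hm
    induction hm using Submodule.smul_induction_on' with
    | smul r hr w _ =>
      obtain ⟨z, rfl⟩ := Ideal.mem_span_singleton.1 (MD_le Q hh ha hb hc hr)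
      exact ⟨z • w, by rw [smul_smul]⟩
    | add m _ m' _ hm hm' =>
      obtain ⟨w, rfl⟩ := hm
      obtain ⟨w', rfl⟩ := hm'
      exact ⟨w + w', by rw [smul_add]⟩
  exact mem_reflexiveHull_iff (pow_ne_zero (n * n) (x_pow_ne_zero ha))
    (pow_ne_zero _ (t_pow_ne_zero hc)) ((isRegularPair_center Q hh ha hb).pow _ (n * n))
    hle (hmem (isHomogeneousUnit_x ha)) (hmem (isHomogeneousUnit_y hb)) d

theorem isReflexiveHullDiscriminant_iff (d : Subalgebra.center k (GWA k σ h)) :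
    IsReflexiveHullDiscriminant (Subalgebra.center k (GWA k σ h)) (GWA k σ h) d ↔
      ∃ u : (Subalgebra.center k (GWA k σ h))ˣ, d = u * c ^ (n * (n - 1)) := by
  have := isDomain_center (σ := σ) hh
  have h1 : reflexiveDiscriminantIdeal (Subalgebra.center k (GWA k σ h)) (GWA k σ h) =
      Ideal.span {c ^ (n * (n - 1))} := by
    ext d
    rw [mem_reflexiveDiscriminantIdeal_iff Q hh ha hb hc, Ideal.mem_span_singleton]
    rfl
  constructor
  · intro H
    obtain ⟨u, hu⟩ := Ideal.span_singleton_eq_span_singleton.1 (h1.symm.trans H.generates)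
    exact ⟨u, by rw [← hu, mul_comm]⟩
  · rintro ⟨u, rfl⟩
    refine ⟨discriminantHypothesis Q hh ha hb, h1.trans ?_⟩
    exact (Ideal.span_singleton_mul_left_unit u.isUnit _).symm

theorem isExtendedReflexiveHullDiscriminant_iff (d : GWA k σ h) :
    IsExtendedReflexiveHullDiscriminant (Subalgebra.center k (GWA k σ h)) (GWA k σ h) d ↔
      ∃ u : (GWA k σ h)ˣ, d = u * (c ^ (n * (n - 1)) : Subalgebra.center k (GWA k σ h)) := by
  have := GWA.isDomain σ hh
  have hC0 : ((c ^ (n * (n - 1)) : Subalgebra.center k (GWA k σ h)) : GWA k σ h) ≠ 0 := by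
    have := isDomain_center (σ := σ) hh
    exact fun h0 => pow_ne_zero _ (t_pow_ne_zero hc) (Subtype.val_injective h0)
  have hmem := mem_extendedReflexiveDiscriminantIdeal_iff Q hh ha hb hc
  generalize c ^ (n * (n - 1)) = C at hC0 hmem ⊢
  have hcomm : ∀ w, w * (C : GWA k σ h) = C * w := Subalgebra.mem_center_iff.1 C.2
  replace hmem : ∀ d, d ∈ extendedReflexiveDiscriminantIdeal (Subalgebra.center k (GWA k σ h))
      (GWA k σ h) ↔ ∃ w, d = C * w := hmem
  constructor
  · intro H
    have h1 : ∀ w, (∃ v, d * v = w) ↔ ∃ v, w = C * v := fun w =>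
      (Set.ext_iff.1 H.generates w).symm.trans (hmem w)
    -- From `dW = CW` come `d = C u` and `C = d v`; cancelling `C` gives `u v = 1`, and in a domain
    -- a one-sided inverse is two-sided.
    obtain ⟨u, hu⟩ := (h1 d).1 ⟨1, mul_one d⟩
    obtain ⟨v, hv⟩ := (h1 C).2 ⟨1, (mul_one _).symm⟩
    have huv : u * v = 1 := by
      apply mul_left_cancel₀ hC0
      rw [← mul_assoc, ← hu, hv, mul_one]
    have hvu : v * u = 1 := by
      have hv0 : u ≠ 0 := left_ne_zero_of_mul_eq_one huv
      apply mul_left_cancel₀ hv0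
      rw [← mul_assoc, huv, one_mul, mul_one]
    exact ⟨⟨u, v, huv, hvu⟩, hu.trans (hcomm u).symm⟩
  · rintro ⟨u, rfl⟩
    refine ⟨discriminantHypothesis Q hh ha hb, isReflexive_center Q hh ha hb, ?_, ?_⟩
    · ext w
      constructor
      · rintro ⟨v, rfl⟩
        refine ⟨u * v * ↑u⁻¹, ?_⟩
        change (u * v * ↑u⁻¹ : GWA k σ h) * (u * C) = u * C * v
        rw [mul_assoc (u * v : GWA k σ h), Units.inv_mul_cancel_left, mul_assoc, hcomm v,
          ← mul_assoc]
      · rintro ⟨v, rfl⟩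
        refine ⟨↑u⁻¹ * v * u, ?_⟩
        change (u * C : GWA k σ h) * (↑u⁻¹ * v * u) = v * (u * C)
        rw [hcomm, mul_assoc, mul_assoc (↑u⁻¹ : GWA k σ h), Units.mul_inv_cancel_left, ← hcomm,
          mul_assoc, hcomm]
    · ext w
      refine (hmem w).trans ⟨?_, ?_⟩
      · rintro ⟨v, rfl⟩
        refine ⟨↑u⁻¹ * v, ?_⟩
        change (u * C : GWA k σ h) * (↑u⁻¹ * v) = C * v
        rw [hcomm, mul_assoc, Units.mul_inv_cancel_left]
      · rintro ⟨v, rfl⟩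
        refine ⟨u * v, ?_⟩
        change (u * C : GWA k σ h) * v = C * (u * v)
        rw [hcomm, mul_assoc]

end Structure

end GWA

/-! ### Normal form of polynomials in `a, b, c` -/

section LaurentCombination

variable {k A : Type*} [CommRing k] [CommRing A] [Algebra k A]

/-- The combination of the monomials `a ^ i` and `b ^ i` with coefficients polynomials in `c`. -/
noncomputable def laurentCombination (a b c : A) : (ℤ →₀ k[X]) →+ A :=
  Finsupp.liftAddHom fun i =>
    (AddMonoidHom.mulRight (if 0 ≤ i then a ^ i.toNat else b ^ (-i).toNat)).comp
      (aeval c : k[X] →ₐ[k] A)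

theorem laurentCombination_single (a b c : A) (i : ℤ) (f : k[X]) :
    laurentCombination a b c (Finsupp.single i f) =
      aeval c f * if 0 ≤ i then a ^ i.toNat else b ^ (-i).toNat := by
  rw [laurentCombination, Finsupp.liftAddHom_apply_single]
  rfl

theorem map_laurentCombination {A' : Type*} [CommRing A'] [Algebra k A'] (φ : A →ₐ[k] A')
    (a b c : A) (g : ℤ →₀ k[X]) :
    φ (laurentCombination a b c g) = laurentCombination (φ a) (φ b) (φ c) g := by
  induction g using Finsupp.induction_linear with
  | zero => simp
  | add g g' hg hg' => rw [map_add, map_add, hg, hg', map_add]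
  | single i f =>
    rw [laurentCombination_single, laurentCombination_single, map_mul, aeval_algHom_apply,
      apply_ite φ, map_pow, map_pow]

/-- If `a b = p(c)`, every polynomial in `a, b, c` is such a combination. -/
theorem exists_aeval_eq_laurentCombination {a b c : A} {p : k[X]} (hab : a * b = aeval c p)
    (F : MvPolynomial (Fin 3) k) :
    ∃ g : ℤ →₀ k[X], MvPolynomial.aeval ![a, b, c] F = laurentCombination a b c g := by
  have key : ∀ u : A, (∀ (i : ℤ) (f : k[X]), ∃ g : ℤ →₀ k[X],
      (aeval c f * if 0 ≤ i then a ^ i.toNat else b ^ (-i).toNat) * u =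
      laurentCombination a b c g) → ∀ g, ∃ g' : ℤ →₀ k[X], laurentCombination (k := k) a b c g * u =
      laurentCombination a b c g' := by
    intro u hu g
    induction g using Finsupp.induction_linear with
    | zero => exact ⟨0, by simp⟩
    | add g₁ g₂ h₁ h₂ =>
      obtain ⟨g₁', h₁⟩ := h₁
      obtain ⟨g₂', h₂⟩ := h₂
      exact ⟨g₁' + g₂', by rw [map_add, add_mul, h₁, h₂, map_add]⟩
    | single i f =>
      rw [laurentCombination_single]
      exact hu i f
  induction F using MvPolynomial.induction_on with
  | C r =>
    refine ⟨Finsupp.single 0 (C r), ?_⟩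
    rw [laurentCombination_single]
    simp
  | add F F' hF hF' =>
    obtain ⟨g, hg⟩ := hF
    obtain ⟨g', hg'⟩ := hF'
    exact ⟨g + g', by rw [map_add, map_add, hg, hg']⟩
  | mul_X F j hF =>
    obtain ⟨g, hg⟩ := hF
    rw [map_mul, hg, MvPolynomial.aeval_X]
    fin_cases j
    -- Multiplying by `a` raises the degree by one; on a positive power of `b`, the product `a b =
    -- p(c)` is absorbed into the coefficient. The case of `b` below is symmetric.
    · refine key a (fun i f => ?_) g
      rcases Int.lt_or_le i 0 with hi | hi
      · refine ⟨Finsupp.single (i + 1) (f * p), ?_⟩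
        obtain ⟨m, rfl⟩ : ∃ m : ℕ, i = -(m + 1) := ⟨(-i).toNat - 1, by omega⟩
        have h1 : (if 0 ≤ -((m : ℤ) + 1) + 1 then a ^ (-((m : ℤ) + 1) + 1).toNat
            else b ^ (-(-((m : ℤ) + 1) + 1)).toNat) = b ^ m := by
          rcases m with _ | m
          · simp
          · rw [if_neg (by omega)]
            congr 1
        rw [laurentCombination_single, h1, if_neg (by omega), map_mul, ← hab,
          (by omega : (-(-((m : ℤ) + 1))).toNat = m + 1)]
        ring
      · refine ⟨Finsupp.single (i + 1) f, ?_⟩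
        rw [laurentCombination_single, if_pos hi, if_pos (by omega),
          (by omega : (i + 1).toNat = i.toNat + 1)]
        ring
    · refine key b (fun i f => ?_) g
      rcases Int.lt_or_le 0 i with hi | hi
      · refine ⟨Finsupp.single (i - 1) (f * p), ?_⟩
        rw [laurentCombination_single, if_pos hi.le, if_pos (by omega), map_mul, ← hab,
          (by omega : i.toNat = (i - 1).toNat + 1)]
        ring
      · refine ⟨Finsupp.single (i - 1) f, ?_⟩
        have h1 : (if 0 ≤ i then a ^ i.toNat else b ^ (-i).toNat) = b ^ (-i).toNat := by
          split_ifs with h0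
          · obtain rfl : i = 0 := by omega
            simp
          · rfl
        rw [laurentCombination_single, h1, if_neg (by omega),
          (by omega : (-(i - 1)).toNat = (-i).toNat + 1)]
        ring
    · refine key c (fun i f => ⟨Finsupp.single i (f * X), ?_⟩) g
      rw [laurentCombination_single, map_mul, aeval_X]
      ring

end LaurentCombination

/-! ### Presentation of the center -/

namespace GWA

open SkewLaurent

variable {k : Type*} [Field k] {σ : k[X] ≃ₐ[k] k[X]} {h : k[X]} {n : ℕ}
  (Q : IsQuantumShift σ n) (hh : h ≠ 0)

include Q

/-- Modulo `n` the exponents `-1, …, -n` are `n - 1, …, 0`. -/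
theorem weight_eq_prod : weight σ h n = ∏ j ∈ Finset.range n, (σ ^ j) h := by
  rw [weight, ← Finset.prod_range_reflect fun j => (σ ^ j) h]
  refine Finset.prod_congr rfl fun j hj => ?_
  have h1 := Finset.mem_range.1 hj
  have h2 : (-((j : ℤ) + 1)) = -n + (n - 1 - j : ℕ) := by omega
  rw [h2, zpow_add, zpow_natCast, AlgEquiv.mul_apply, Q.zpow_apply (dvd_neg.2 dvd_rfl)]

variable {a b c : Subalgebra.center k (GWA k σ h)}
  (ha : (a : GWA k σ h) = x σ h ^ n) (hb : (b : GWA k σ h) = y σ h ^ n)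
  (hc : (c : GWA k σ h) = ofBase σ h X ^ n)

omit Q in
include hc in
theorem coe_aeval_t_pow (f : k[X]) :
    (aeval c f : Subalgebra.center k (GWA k σ h)) = ofBase σ h (expand k n f) := by
  have h1 : (aeval c f : Subalgebra.center k (GWA k σ h)) =
      aeval ((Subalgebra.center k (GWA k σ h)).val c) f :=
    (aeval_algHom_apply (Subalgebra.center k (GWA k σ h)).val c f).symm
  rw [h1, Subalgebra.coe_val, hc, ← map_pow, aeval_algHom_apply, expand_eq_comp_X_pow,
    comp_eq_aeval]

include hh ha hb hc

omit hh in
theorem cf_emb_laurentCombination (g : ℤ →₀ k[X]) (l : ℤ) :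
    cf σ (emb σ h (laurentCombination a b c g : Subalgebra.center k (GWA k σ h))) l =
      if (n : ℤ) ∣ l then expand k n (g (l / n)) * weight σ h (-l).toNat else 0 := by
  have hn : (n : ℤ) ≠ 0 := by exact_mod_cast Q.pos.ne'
  induction g using Finsupp.induction_linear with
  | zero => simp
  | add g g' hg hg' =>
    rw [map_add, AddMemClass.coe_add, map_add, map_add, Finsupp.add_apply, hg, hg']
    split_ifs
    · rw [Finsupp.add_apply, map_add, add_mul]
    · simp
  | single i f =>
    have h1 : emb σ h (if 0 ≤ i then a ^ i.toNat else b ^ (-i).toNat :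
        Subalgebra.center k (GWA k σ h)) =
        term σ (n * i) (weight σ h (-(n * i)).toNat) := by
      split_ifs with hi
      · obtain ⟨m, rfl⟩ := Int.eq_ofNat_of_zero_le hi
        rw [SubmonoidClass.coe_pow, ha, ← pow_mul, emb_x_pow, Int.toNat_natCast, ← Nat.cast_mul,
          Int.toNat_neg_natCast, weight_zero]
      · obtain ⟨m, rfl⟩ : ∃ m : ℕ, i = -m := ⟨(-i).toNat, by omega⟩
        rw [SubmonoidClass.coe_pow, hb, ← pow_mul, emb_y_pow, neg_neg, Int.toNat_natCast, mul_neg,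
          ← Nat.cast_mul, neg_neg, Int.toNat_natCast]
    rw [laurentCombination_single, MulMemClass.coe_mul, map_mul, h1, coe_aeval_t_pow hc, emb_ofBase,
      term_mul_term, zpow_zero, AlgEquiv.one_apply, zero_add, cf_term, Finsupp.single_apply]
    by_cases hl : (n : ℤ) ∣ l
    · obtain ⟨j, rfl⟩ := hl
      rw [if_pos (dvd_mul_right _ _), Int.mul_ediv_cancel_left _ hn]
      by_cases hij : i = j
      · subst hij; simp
      · rw [if_neg hij, if_neg fun h => hij (mul_left_cancel₀ hn h), map_zero, zero_mul]
    · rw [if_neg hl, if_neg (by rintro rfl; exact hl (dvd_mul_right _ _))]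

theorem laurentCombination_injective :
    Function.Injective (laurentCombination (k := k) a b c) := by
  have hn : (n : ℤ) ≠ 0 := by exact_mod_cast Q.pos.ne'
  refine (injective_iff_map_eq_zero _).2 fun g hg => ?_
  ext1 i
  have h1 := cf_emb_laurentCombination Q ha hb hc g (n * i)
  rw [hg, ZeroMemClass.coe_zero, map_zero, map_zero, Finsupp.zero_apply,
    if_pos (dvd_mul_right _ _), Int.mul_ediv_cancel_left _ hn] at h1
  have h2 := (mul_eq_zero.1 h1.symm).resolve_right (weight_ne_zero σ hh _)
  exact expand_injective Q.pos (h2.trans (map_zero _).symm)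

/-- A central element has coefficients `g l * weight` that are fixed and vanish unless `n ∣ l`.
Cancelling the fixed weight shows that `g l` is fixed, hence a polynomial in `X ^ n`. -/
theorem laurentCombination_surjective :
    Function.Surjective (laurentCombination (k := k) a b c) := by
  have hn : (n : ℤ) ≠ 0 := by exact_mod_cast Q.pos.ne'
  intro z
  obtain ⟨g, hg⟩ := combination_surjective σ h (z : GWA k σ h)
  refine ⟨Finsupp.mapRange (contract n) (by ext; simp [coeff_contract Q.pos.ne'])
    (Finsupp.comapDomain (fun i => (n : ℤ) * i) g (mul_right_injective₀ hn).injOn),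
    center_ext hh (ext_cf fun l => ?_)⟩
  rw [cf_emb_laurentCombination Q ha hb hc, Finsupp.mapRange_apply, Finsupp.comapDomain_apply]
  have h1 := (mem_center_iff Q hh _).1 z.2 l
  rw [← hg, cf_emb_combination] at h1 ⊢
  split_ifs with hl
  · rw [Int.mul_ediv_cancel' hl]
    congr 1
    refine Q.fix _ (mul_right_cancel₀ (weight_ne_zero σ hh (-l).toNat) ?_)
    rw [← h1.2, map_mul, map_weight_of_dvd Q hh hl]
  · exact (h1.1 hl).symm

theorem aeval_surjective : Function.Surjective (MvPolynomial.aeval (R := k) ![a, b, c]) := by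
  intro z
  obtain ⟨g, rfl⟩ := laurentCombination_surjective Q hh ha hb hc z
  refine ⟨laurentCombination (MvPolynomial.X 0) (MvPolynomial.X 1) (MvPolynomial.X 2) g, ?_⟩
  rw [map_laurentCombination]
  simp

variable {p : k[X]} (hp : expand k n p = weight σ h n)

include hp

theorem x_pow_mul_y_pow : a * b = aeval c p := by
  apply center_ext hh
  rw [coe_aeval_t_pow hc, hp, MulMemClass.coe_mul, map_mul, ha, hb, emb_x_pow, emb_y_pow,
    term_mul_term, Q.zpow_apply dvd_rfl, one_mul, add_neg_cancel, emb_ofBase]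

/-- Modulo the relation every polynomial is a Laurent combination, and these map injectively to the
center. So a polynomial in the kernel has zero normal form and lies in the ideal. -/
theorem ker_aeval : RingHom.ker (MvPolynomial.aeval (R := k) ![a, b, c]) =
    Ideal.span {MvPolynomial.X 0 * MvPolynomial.X 1 -
      Polynomial.aeval (MvPolynomial.X 2 : MvPolynomial (Fin 3) k) p} := by
  set I := Ideal.span {MvPolynomial.X 0 * MvPolynomial.X 1 -
      Polynomial.aeval (MvPolynomial.X 2 : MvPolynomial (Fin 3) k) p} with hI
  have hle : I ≤ RingHom.ker (MvPolynomial.aeval (R := k) ![a, b, c]) := by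
    rw [hI, Ideal.span_singleton_le_iff_mem, RingHom.mem_ker, map_sub, map_mul,
      ← aeval_algHom_apply]
    simp [x_pow_mul_y_pow Q hh ha hb hc hp]
  refine le_antisymm (fun F hF => ?_) hle
  let π : MvPolynomial (Fin 3) k →ₐ[k] MvPolynomial (Fin 3) k ⧸ I := Ideal.Quotient.mkₐ k I
  have hπ : MvPolynomial.aeval ![π (MvPolynomial.X 0), π (MvPolynomial.X 1),
      π (MvPolynomial.X 2)] = π := by
    refine MvPolynomial.algHom_ext fun i => ?_
    rw [MvPolynomial.aeval_X]
    fin_cases i <;> rfl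
  have hrel : π (MvPolynomial.X 0) * π (MvPolynomial.X 1) = aeval (π (MvPolynomial.X 2)) p := by
    rw [← map_mul, aeval_algHom_apply]
    exact Ideal.Quotient.eq.2 (Ideal.mem_span_singleton_self _)
  obtain ⟨g, hg⟩ := exists_aeval_eq_laurentCombination hrel F
  rw [hπ] at hg
  let ψ := Ideal.Quotient.liftₐ I (MvPolynomial.aeval (R := k) ![a, b, c]) fun F hF => hle hF
  have hψ : ∀ F, ψ (π F) = MvPolynomial.aeval ![a, b, c] F := fun F => rfl
  have h1 := congrArg ψ hg
  rw [map_laurentCombination, hψ, hψ, hψ, hψ, RingHom.mem_ker.1 hF] at h1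
  simp only [MvPolynomial.aeval_X] at h1
  have h2 : g = 0 := laurentCombination_injective Q hh ha hb hc (h1.symm.trans (map_zero _).symm)
  rw [h2, map_zero] at hg
  exact Ideal.Quotient.eq_zero_iff_mem.1 hg

end GWA

theorem theorem5p11 {k : Type*} [Field k]
    (σ : k[X] ≃ₐ[k] k[X]) (q : kˣ) (hσ : σ X = C (q : k) * X)
    (h : k[X]) (hh : h ≠ 0)
    (n : ℕ) (hn : 0 < n) (hord : orderOf σ = n) :
    ∃ (p : k[X]) (a b c : Subalgebra.center k (GWA k σ h)),
      -- the center of `W` is `k[a, b, c] / (ab - p(c))` with `a = x ^ n`, `b = y ^ n`, `c = t ^ n`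
      ((a : GWA k σ h) = GWA.x σ h ^ n ∧
        (b : GWA k σ h) = GWA.y σ h ^ n ∧
        (c : GWA k σ h) = GWA.ofBase σ h X ^ n) ∧
      p.comp (X ^ n) = ∏ j ∈ Finset.range n, h.comp (C ((q : k) ^ j) * X) ∧
      Function.Surjective (MvPolynomial.aeval (R := k) ![a, b, c]) ∧
      RingHom.ker (MvPolynomial.aeval (R := k) ![a, b, c]) =
        Ideal.span {MvPolynomial.X 0 * MvPolynomial.X 1 -
          Polynomial.aeval (MvPolynomial.X 2 : MvPolynomial (Fin 3) k) p} ∧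
      -- the reflexive hull discriminants and the extended ones
      ((c ^ (n * (n - 1)) : Subalgebra.center k (GWA k σ h)) : GWA k σ h) =
        GWA.ofBase σ h X ^ (n ^ 2 * (n - 1)) ∧
      (∀ d : Subalgebra.center k (GWA k σ h),
        IsReflexiveHullDiscriminant (Subalgebra.center k (GWA k σ h)) (GWA k σ h) d ↔
          ∃ u : (Subalgebra.center k (GWA k σ h))ˣ, d = u * c ^ (n * (n - 1))) ∧
      (∀ d : GWA k σ h,
        IsExtendedReflexiveHullDiscriminant (Subalgebra.center k (GWA k σ h)) (GWA k σ h) d ↔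
          ∃ u : (GWA k σ h)ˣ, d = u * GWA.ofBase σ h X ^ (n ^ 2 * (n - 1))) := by
  have Q := IsQuantumShift.of_orderOf q hσ hn hord
  let a : Subalgebra.center k (GWA k σ h) := ⟨_, GWA.x_pow_mem_center Q hh⟩
  let b : Subalgebra.center k (GWA k σ h) := ⟨_, GWA.y_pow_mem_center Q hh⟩
  let c : Subalgebra.center k (GWA k σ h) := ⟨_, GWA.t_pow_mem_center Q hh⟩
  -- The polynomial `p` is `weight n` rewritten in `X ^ n`, which is possible because `weight n` is
  -- fixed by `σ`.
  have hp : expand k n (contract n (GWA.weight σ h n)) = GWA.weight σ h n :=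
    Q.fix _ (GWA.map_weight Q hh)
  have hcpow : ((c ^ (n * (n - 1)) : Subalgebra.center k (GWA k σ h)) : GWA k σ h) =
      GWA.ofBase σ h X ^ (n ^ 2 * (n - 1)) := by
    rw [SubmonoidClass.coe_pow, ← pow_mul, ← mul_assoc, ← pow_two]
  refine ⟨contract n (GWA.weight σ h n), a, b, c, ⟨rfl, rfl, rfl⟩, ?_,
    GWA.aeval_surjective Q hh rfl rfl rfl, GWA.ker_aeval Q hh rfl rfl rfl hp, hcpow,
    GWA.isReflexiveHullDiscriminant_iff (a := a) (b := b) Q hh rfl rfl rfl, ?_⟩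
  · rw [← expand_eq_comp_X_pow, hp, GWA.weight_eq_prod Q]
    exact Finset.prod_congr rfl fun j _ => shift_pow_apply hσ j h
  · rw [← hcpow]
    exact GWA.isExtendedReflexiveHullDiscriminant_iff (a := a) (b := b) Q hh rfl rfl rfl
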